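/- Let $k$ be a field of characteristic not $2$. For a field $F$ of characteristic not $2$, let $\mathrm{Quat}^*(F)$ be the set of isomorphism classes of quaternion division algebras with center $F$. For a division algebra $D$ with center $F$, a maximal subfield of $D$ is a maximal element among the fields $E$ with $F\subseteq E\subseteq D$; two division algebras with center $F$ are linked if some maximal subfield of one is $F$-isomorphic to a maximal subfield of the other, and weakly isomorphic if they have the same set of $F$-isomorphism classes of maximal subfields. Let $\mathcal D\subset \mathrm{Quat}^*(k)$ be a set whose elements are pairwise linked. Then there exists a field extension $K/k$ such that 1. for every $D\in\mathcal D$ the algebra $D\otimes_k K$ is a division algebra, and the resulting map $\mathcal D\to \mathrm{Quat}^*(K)$, $D\mapsto D\otimes_k K$, is injective; and 2. the algebras $D\otimes_k K$, $D\in\mathcal D$, are pairwise weakly isomorphic. -/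

import Mathlib

universe u

open scoped TensorProduct Quaternion

/-- Two `k`-algebras are identified when they are isomorphic as `k`-algebras. -/
def algIsoSetoid (k : Type u) [Field k] : Setoid (AlgCat.{u} k) where
  r A B := Nonempty (A ≃ₐ[k] B)
  iseqv :=
    { refl := fun _ => ⟨AlgEquiv.refl⟩
      symm := fun ⟨e⟩ => ⟨e.symm⟩
      trans := fun ⟨e⟩ ⟨f⟩ => ⟨e.trans f⟩ }

/-- Isomorphism classes of (associative, unital) `k`-algebras. -/
def AlgClass (k : Type u) [Field k] : Type (u + 1) :=
  Quotient (algIsoSetoid k)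

/-- The isomorphism class of a `k`-algebra. -/
def algClass (k : Type u) [Field k] (A : Type u) [Ring A] [Algebra k A] : AlgClass k :=
  Quotient.mk (algIsoSetoid k) (AlgCat.of k A)

/-- `Quat k`: isomorphism classes of quaternion algebras over a field `k` of characteristic
not 2, i.e. of the algebras `(a, b / k)` with `a, b ∈ kˣ`, generated by `i`, `j` subject to
`i² = a`, `j² = b`, `ij = -ji`. -/
def Quat (k : Type u) [Field k] : Set (AlgClass k) :=
  {c | ∃ a b : k, a ≠ 0 ∧ b ≠ 0 ∧ c = algClass k ℍ[k,a,b]}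

/-- A ring is a division ring if it is nonzero and all its nonzero elements are units. -/
def IsDivision (A : Type u) [Ring A] : Prop :=
  Nontrivial A ∧ ∀ x : A, x ≠ 0 → IsUnit x

/-- `Quat* k`: isomorphism classes of quaternion division algebras over `k`. -/
def QuatStar (k : Type u) [Field k] : Set (AlgClass k) :=
  {c | c ∈ Quat k ∧ ∃ A : AlgCat.{u} k, c = algClass k A ∧ IsDivision A}

/-- The maximal subfields of `A`: the maximal elements among the subfields `E` with
`k ⊆ E ⊆ A`. -/
def IsMaximalSubfield (k : Type u) [Field k] {A : Type u} [Ring A] [Algebra k A]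
    (E : Subalgebra k A) : Prop :=
  Maximal (fun E' : Subalgebra k A => IsField E') E

/-- `Max(D)`: the set of `k`-isomorphism classes of maximal subfields of `D`, where `D` is given
by its isomorphism class. -/
def maxSpectrum {k : Type u} [Field k] (D : AlgClass k) : Set (AlgClass k) :=
  {L | ∃ A : AlgCat.{u} k, D = algClass k A ∧
    ∃ E : Subalgebra k A, IsMaximalSubfield k E ∧ L = algClass k E}

/-- Linked algebras: they share a common maximal subfield, up to `k`-isomorphism. -/
def Linked {k : Type u} [Field k] (D D' : AlgClass k) : Prop :=
  (maxSpectrum D ∩ maxSpectrum D').Nonempty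

/-- Weakly isomorphic algebras: they have the same maximal subfield spectrum. -/
def WeaklyIsomorphic {k : Type u} [Field k] (D D' : AlgClass k) : Prop :=
  maxSpectrum D = maxSpectrum D'

/-- Extension of scalars `D ↦ K ⊗ D` on isomorphism classes of algebras. -/
def scalarExt (k K : Type u) [Field k] [Field K] [Algebra k K] : AlgClass k → AlgClass K :=
  Quotient.map (fun A : AlgCat.{u} k => AlgCat.of K (K ⊗[k] A))
    (fun _ _ ⟨e⟩ => ⟨Algebra.TensorProduct.congr (AlgEquiv.refl : K ≃ₐ[K] K) e⟩)

/-!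
The extension `K` is universal: over `K`, every nonsquare `d` is the square of a pure quaternion in
every quaternion algebra, so that all quaternion division algebras over `K` have the same maximal
subfields `K(√d)`, while division quaternion algebras over `k` remain division over `K`. Inside an
algebraically closed field with many independent transcendentals, Zorn's lemma reduces this to
adjoining a generic solution of `a x² + b y² - a b z² = d` to an intermediate field `F`. If a
division algebra `(a', b')` over `F` became split over `F(y)(x)(z)`, then `z² ∈ F(y)(x)` would be
the square of a pure quaternion over `F(y)(x)`; descending along `x` and then along `y` with the
Cassels–Pfister theorem forces `d` to be a square in `F`. Injectivity on linked algebras holds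
because `(d, c) ≅ (d, c')` exactly when `(d, c c')` is not a division algebra, a condition that is
the same over `k` and over `K`.
-/

open Polynomial QuadraticMap IntermediateField

section WeightedSumSquares

variable {K ι : Type*} [Field K] [Fintype ι] {c : ι → K}

theorem map_weightedSumSquares {R S : Type*} [CommRing R] [CommRing S] [Algebra K R] [Algebra K S]
    (f : R →ₐ[K] S) (c : ι → K) (v : ι → R) :
    f (weightedSumSquares R c v) = weightedSumSquares S c (f ∘ v) := by
  simp [weightedSumSquares_apply]

theorem coeff_weightedSumSquares {p : ι → K[X]} {n : ℕ} (hp : ∀ i, (p i).natDegree ≤ n) :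
    (weightedSumSquares K[X] c p).coeff (n + n) =
      weightedSumSquares K c fun i => (p i).coeff n := by
  simp [weightedSumSquares_apply, finsetSum_coeff, coeff_mul_add_eq_of_natDegree_le, hp]

theorem natDegree_weightedSumSquares_le {p : ι → K[X]} {n : ℕ} (hp : ∀ i, (p i).natDegree ≤ n) :
    (weightedSumSquares K[X] c p).natDegree ≤ n + n := by
  rw [weightedSumSquares_apply]
  refine natDegree_sum_le_of_forall_le _ _ fun i _ => (natDegree_smul_le _ _).trans ?_
  exact natDegree_mul_le_of_le (hp i) (hp i)

/-- Leading coefficients cannot cancel in an anisotropic form. -/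
theorem natDegree_le_of_natDegree_weightedSumSquares_le (hc : (weightedSumSquares K c).Anisotropic)
    {p : ι → K[X]} {m : ℕ} (hp : (weightedSumSquares K[X] c p).natDegree ≤ m + m) (i : ι) :
    (p i).natDegree ≤ m := by
  by_contra! hi
  obtain ⟨j, -, hj⟩ :=
    Finset.exists_max_image Finset.univ (fun i => (p i).natDegree) ⟨i, Finset.mem_univ i⟩
  have hmj : m < (p j).natDegree := hi.trans_le (hj i (Finset.mem_univ i))
  have hcoeff := coeff_weightedSumSquares (c := c) fun i => hj i (Finset.mem_univ i)
  rw [coeff_eq_zero_of_natDegree_lt (by lia)] at hcoeff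
  have hlead : (p j).leadingCoeff = 0 := congrFun (hc _ hcoeff.symm) j
  rw [leadingCoeff_eq_zero.1 hlead, natDegree_zero] at hmj
  exact not_lt_zero hmj

theorem anisotropic_polynomial (hc : (weightedSumSquares K c).Anisotropic) :
    (weightedSumSquares K[X] c).Anisotropic := by
  intro p hp
  have hdeg : ∀ i, (p i).natDegree ≤ 0 :=
    natDegree_le_of_natDegree_weightedSumSquares_le hc (by simp [hp])
  have hcoeff := coeff_weightedSumSquares (c := c) hdeg
  rw [hp, coeff_zero] at hcoeff
  funext i
  rw [eq_C_of_natDegree_le_zero (hdeg i), congrFun (hc _ hcoeff.symm) i, Pi.zero_apply, C_0,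
    Pi.zero_apply]

/-- The descent step in the theorem of Cassels and Pfister: geometrically, the line through `m`
and `m + h⁻¹ • r` meets the quadric `Q = g` in a second point, with denominator `k`. -/
theorem map_second_intersection {R M : Type*} [CommRing R] [IsDomain R] [AddCommGroup M]
    [Module R M] (Q : QuadraticForm R M) {h k g : R} {m r : M} (hh : h ≠ 0)
    (hmr : Q (h • m + r) = h * h * g) (hr : Q r = h * k) :
    Q (-k • m + (g - Q m) • r) = k * k * g := by
  rw [QuadraticMap.map_add Q, QuadraticMap.map_smul, polar_smul_left, hr] at hmr
  simp only [smul_eq_mul] at hmr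
  have hk : k = h * g - h * Q m - polar Q m r :=
    mul_left_cancel₀ hh (by linear_combination hmr)
  rw [QuadraticMap.map_add Q, QuadraticMap.map_smul, QuadraticMap.map_smul, polar_smul_left,
    polar_smul_right, hr]
  simp only [smul_eq_mul]
  linear_combination -k * (g - Q m) * hk

theorem exists_weightedSumSquares_eq_of_mul_self_mul (hc : (weightedSumSquares K c).Anisotropic)
    {g h : K[X]} {p : ι → K[X]} (hh : h ≠ 0) (hp : weightedSumSquares K[X] c p = h * h * g) :
    ∃ q : ι → K[X], weightedSumSquares K[X] c q = g := by
  induction hn : h.natDegree using Nat.strong_induction_on generalizing h p with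
  | _ n ih =>
  set Q := weightedSumSquares K[X] c
  let m : ι → K[X] := fun i => p i / h
  let r : ι → K[X] := fun i => p i % h
  have hmr : Q (h • m + r) = h * h * g := by
    rw [← hp]
    exact congrArg Q (funext fun i => EuclideanDomain.div_add_mod (p i) h)
  by_cases hr : r = 0
  · refine ⟨m, mul_left_cancel₀ (mul_ne_zero hh hh) ?_⟩
    rw [← hmr, hr, add_zero, QuadraticMap.map_smul, smul_eq_mul]
  obtain ⟨k, hk⟩ : h ∣ Q r := by
    rw [QuadraticMap.map_add Q, QuadraticMap.map_smul, polar_smul_left] at hmr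
    exact ⟨h * g - h * Q m - polar Q m r, by linear_combination hmr⟩
  have hk0 : k ≠ 0 := by
    rintro rfl
    exact hr (anisotropic_polynomial hc r (by rw [hk, mul_zero]))
  have hdeg : h.natDegree ≠ 0 := fun h0 => hr <| funext fun i =>
    EuclideanDomain.mod_eq_zero.2
      (isUnit_iff_degree_eq_zero.2 (by rw [degree_eq_natDegree hh, h0, Nat.cast_zero])).dvd
  have hkn : k.natDegree < n := by
    have hQr : (Q r).natDegree ≤ (n - 1) + (n - 1) := natDegree_weightedSumSquares_le fun i => by
      have := natDegree_mod_lt (p i) hdeg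
      lia
    rw [hk, natDegree_mul hh hk0] at hQr
    lia
  exact ih _ hkn hk0 (map_second_intersection Q hh hmr hk) rfl

theorem exists_algebraMap_comp_eq_smul {ι : Type*} [Finite ι] (v : ι → RatFunc K) :
    ∃ h : K[X], h ≠ 0 ∧ ∃ p : ι → K[X],
      algebraMap K[X] (RatFunc K) ∘ p = algebraMap K[X] (RatFunc K) h • v := by
  obtain ⟨⟨h, hh⟩, hint⟩ :=
    IsLocalization.exist_integer_multiples_of_finite (nonZeroDivisors K[X]) v
  choose p hp using hint
  exact ⟨h, nonZeroDivisors.ne_zero hh, p, funext fun i => (hp i).trans (Algebra.smul_def _ _)⟩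

theorem algebraMap_weightedSumSquares {v : ι → RatFunc K} {h : K[X]} {p : ι → K[X]}
    (hp : algebraMap K[X] (RatFunc K) ∘ p = algebraMap K[X] (RatFunc K) h • v) :
    algebraMap K[X] (RatFunc K) (weightedSumSquares K[X] c p) =
      algebraMap K[X] (RatFunc K) (h * h) * weightedSumSquares (RatFunc K) c v := by
  rw [map_mul, ← smul_eq_mul, ← QuadraticMap.map_smul, ← hp]
  exact map_weightedSumSquares (IsScalarTower.toAlgHom K K[X] (RatFunc K)) c p

theorem cassels_pfister (hc : (weightedSumSquares K c).Anisotropic) {g : K[X]} {v : ι → RatFunc K}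
    (hv : weightedSumSquares (RatFunc K) c v = algebraMap K[X] (RatFunc K) g) :
    ∃ q : ι → K[X], weightedSumSquares K[X] c q = g := by
  obtain ⟨h, hh, p, hp⟩ := exists_algebraMap_comp_eq_smul v
  refine exists_weightedSumSquares_eq_of_mul_self_mul hc hh (p := p) ?_
  apply IsFractionRing.injective K[X] (RatFunc K)
  rw [algebraMap_weightedSumSquares hp, hv, map_mul _ (h * h)]

theorem anisotropic_ratFunc (hc : (weightedSumSquares K c).Anisotropic) :
    (weightedSumSquares (RatFunc K) c).Anisotropic := by
  intro v hv
  obtain ⟨h, hh, p, hp⟩ := exists_algebraMap_comp_eq_smul v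
  have hp0 : p = 0 := by
    refine anisotropic_polynomial hc p (IsFractionRing.injective K[X] (RatFunc K) ?_)
    rw [algebraMap_weightedSumSquares hp, hv, mul_zero, map_zero]
  rw [hp0, Pi.comp_zero, map_zero, Function.const_zero] at hp
  exact (smul_eq_zero.1 hp.symm).resolve_left (by simpa using hh)

variable {L : Type*} [Field L] [Algebra K L] {x : L}

theorem anisotropic_adjoin_simple (hx : Transcendental K x)
    (hc : (weightedSumSquares K c).Anisotropic) : (weightedSumSquares K⟮x⟯ c).Anisotropic := by
  let e := RatFunc.algEquivOfTranscendental x hx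
  intro v hv
  have hev : e.symm ∘ v = 0 := by
    refine anisotropic_ratFunc hc _ ?_
    rw [← AlgEquiv.coe_toAlgHom, ← map_weightedSumSquares, hv, map_zero]
  funext i
  exact (map_eq_zero e.symm).1 (congrFun hev i)

/-- Evaluating a polynomial solution `q` of `Q q = α X² + δ`, which is linear by anisotropy, at `0`
and `1` and comparing leading coefficients yields the three values defining orthogonality. -/
theorem exists_isOrtho_of_represents (hx : Transcendental K x)
    (hc : (weightedSumSquares K c).Anisotropic) {α δ : K} {v : ι → K⟮x⟯}
    (hv : weightedSumSquares K⟮x⟯ c v =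
      algebraMap K K⟮x⟯ α * AdjoinSimple.gen K x ^ 2 + algebraMap K K⟮x⟯ δ) :
    ∃ w₁ w₀ : ι → K, weightedSumSquares K c w₁ = α ∧ weightedSumSquares K c w₀ = δ ∧
      (weightedSumSquares K c).IsOrtho w₁ w₀ := by
  let e := RatFunc.algEquivOfTranscendental x hx
  obtain ⟨q, hq⟩ : ∃ q : ι → K[X], weightedSumSquares K[X] c q = C α * X ^ 2 + C δ := by
    refine cassels_pfister hc (v := e.symm ∘ v) ?_
    rw [← AlgEquiv.coe_toAlgHom, ← map_weightedSumSquares, hv, AlgEquiv.coe_toAlgHom,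
      ← RatFunc.algEquivOfTranscendental_symm_aeval x hx]
    simp [e]
  have hdeg : ∀ i, (q i).natDegree ≤ 1 :=
    natDegree_le_of_natDegree_weightedSumSquares_le hc (by rw [hq]; compute_degree)
  have heval (t : K) : weightedSumSquares K c (fun i => (q i).eval t) = α * t ^ 2 + δ := by
    have := map_weightedSumSquares (aeval (R := K) t) c q
    simpa [hq, Function.comp_def] using this.symm
  have hα : weightedSumSquares K c (fun i => (q i).coeff 1) = α := by
    rw [← coeff_weightedSumSquares hdeg, hq]
    simp
  have hδ : weightedSumSquares K c (fun i => (q i).coeff 0) = δ := by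
    simpa [coeff_zero_eq_eval_zero] using heval 0
  refine ⟨_, _, hα, hδ, isOrtho_def.2 ?_⟩
  rw [hα, hδ]
  have hsum : (fun i => (q i).coeff 1) + (fun i => (q i).coeff 0) = fun i => (q i).eval 1 := by
    funext i
    conv_rhs => rw [eq_X_add_C_of_natDegree_le_one (hdeg i)]
    simp
  rw [hsum, heval]
  ring

end WeightedSumSquares

theorem IsDivision.noZeroDivisors {A : Type*} [Ring A] (h : IsDivision A) : NoZeroDivisors A where
  eq_zero_or_eq_zero_of_mul_eq_zero {x _} hxy :=
    or_iff_not_imp_left.2 fun hx => (h.2 x hx).mul_right_eq_zero.1 hxy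

theorem IsDivision.of_algEquiv {K A B : Type*} [Field K] [Ring A] [Ring B] [Algebra K A]
    [Algebra K B] (h : IsDivision A) (e : A ≃ₐ[K] B) : IsDivision B := by
  have : Nontrivial A := h.1
  refine ⟨e.injective.nontrivial, fun x hx => ?_⟩
  have := (h.2 _ ((map_ne_zero_iff _ e.symm.injective).2 hx)).map e
  rwa [e.apply_symm_apply] at this

/-- The Skolem–Noether theorem for two square roots `v`, `w` of the same scalar: unless `w = -v`,
they are conjugate by `v * w + α`. -/
theorem IsDivision.exists_anticommute_of_mul_self_eq {K A : Type*} [Field K] [Ring A] [Algebra K A]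
    (h : IsDivision A) {α r : K} {v w u : A} (hv : v * v = algebraMap K A α)
    (hw : w * w = algebraMap K A α) (hu : u * u = algebraMap K A r) (hwu : w * u = -(u * w)) :
    ∃ u' : A, u' * u' = algebraMap K A r ∧ v * u' = -(u' * v) := by
  by_cases hg : v * w + algebraMap K A α = 0
  · have := h.noZeroDivisors
    have hvw : v * (w + v) = 0 := by rw [mul_add, hv, hg]
    rcases mul_eq_zero.1 hvw with rfl | hvw
    · exact ⟨u, hu, by simp⟩
    · rw [eq_neg_of_add_eq_zero_right hvw]
      exact ⟨u, hu, by rw [neg_mul, hwu, mul_neg]⟩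
  · obtain ⟨g, hg⟩ := h.2 _ hg
    have hwv : SemiconjBy (g : A) w v := by
      rw [SemiconjBy, hg, mul_add, add_mul, ← mul_assoc, hv, mul_assoc, hw, Algebra.commutes,
        ← Algebra.commutes, add_comm]
    have huu' : SemiconjBy (g : A) u (g * u * ↑g⁻¹) := by simp [SemiconjBy, mul_assoc]
    refine ⟨g * u * ↑g⁻¹, ?_, ?_⟩ <;> rw [← Units.mul_left_inj g]
    · rw [← (huu'.mul_right huu').eq, hu, Algebra.commutes]
    · rw [← (hwv.mul_right huu').eq, hwu, mul_neg, neg_mul, (huu'.mul_right hwv).eq]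

section QuaternionAlgebras

variable {K : Type*} [Field K] {a b : K}

/-- The coefficients of the norm form of the quaternion algebra `(a, b / K)`, with respect to the
basis `1, i, j, ij`. -/
def normCoeff (a b : K) : Fin 4 → K :=
  ![1, -a, -b, a * b]

/-- The coefficients of the quadratic form `q ↦ q²` on the pure quaternions of `(a, b / K)`, with
respect to the basis `i, j, ij`. -/
def pureCoeff (a b : K) : Fin 3 → K :=
  ![a, b, -(a * b)]

/-- The pure quaternion with the given coordinates with respect to the basis `i, j, ij`. -/
def pureQuaternion (a b : K) : (Fin 3 → K) →ₗ[K] ℍ[K,a,b] where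
  toFun v := ⟨0, v 0, v 1, v 2⟩
  map_add' _ _ := by ext <;> simp
  map_smul' _ _ := by ext <;> simp

theorem mul_star_eq_weightedSumSquares (q : ℍ[K,a,b]) :
    q * star q = algebraMap K ℍ[K,a,b]
      (weightedSumSquares K (normCoeff a b) (QuaternionAlgebra.equivTuple a 0 b q)) := by
  rw [QuaternionAlgebra.algebraMap_eq]
  ext <;> simp [normCoeff, Fin.sum_univ_four] <;> ring

theorem commute_star_quaternion (q : ℍ[K,a,b]) : Commute q (star q) := by
  ext <;> simp <;> ring

theorem isDivision_quaternion_iff :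
    IsDivision ℍ[K,a,b] ↔ (weightedSumSquares K (normCoeff a b)).Anisotropic := by
  refine ⟨fun h v hv => ?_, fun h => ⟨inferInstance, fun q hq => ?_⟩⟩
  · have := h.noZeroDivisors
    let e := QuaternionAlgebra.linearEquivTuple a 0 b
    have hnorm : e.symm v * star (e.symm v) = 0 := by
      rw [mul_star_eq_weightedSumSquares, ← QuaternionAlgebra.coe_linearEquivTuple,
        e.apply_symm_apply, hv, map_zero]
    rw [mul_eq_zero, star_eq_zero, or_self] at hnorm
    exact (map_eq_zero_iff _ e.symm.injective).1 hnorm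
  · refine ((commute_star_quaternion q).isUnit_mul_iff.1 ?_).1
    rw [mul_star_eq_weightedSumSquares]
    refine (IsUnit.mk0 _ fun h0 => hq ?_).map _
    exact (map_eq_zero_iff _ (QuaternionAlgebra.linearEquivTuple a 0 b).injective).1 (h _ h0)

theorem pureQuaternion_injective : Function.Injective (pureQuaternion a b) := by
  intro v w h
  simp only [pureQuaternion, LinearMap.coe_mk, AddHom.coe_mk, QuaternionAlgebra.mk.injEq] at h
  funext i
  fin_cases i
  exacts [h.2.1, h.2.2.1, h.2.2.2]

theorem pureQuaternion_mul_self (v : Fin 3 → K) :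
    pureQuaternion a b v * pureQuaternion a b v =
      algebraMap K ℍ[K,a,b] (weightedSumSquares K (pureCoeff a b) v) := by
  rw [QuaternionAlgebra.algebraMap_eq]
  ext <;> simp [pureQuaternion, pureCoeff, Fin.sum_univ_three] <;> ring

theorem pureQuaternion_anticommute {v w : Fin 3 → K}
    (h : (weightedSumSquares K (pureCoeff a b)).IsOrtho v w) :
    pureQuaternion a b v * pureQuaternion a b w =
      -(pureQuaternion a b w * pureQuaternion a b v) := by
  have hsq := pureQuaternion_mul_self (a := a) (b := b) (v + w)
  rw [isOrtho_def.1 h, map_add, map_add, mul_add, add_mul, add_mul, pureQuaternion_mul_self,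
    pureQuaternion_mul_self] at hsq
  rw [eq_neg_iff_add_eq_zero]
  rw [← sub_eq_zero] at hsq
  rw [← hsq]
  abel

theorem IsDivision.anisotropic_pureCoeff (h : IsDivision ℍ[K,a,b]) :
    (weightedSumSquares K (pureCoeff a b)).Anisotropic := by
  intro v hv
  have := h.noZeroDivisors
  refine (map_eq_zero_iff _ (pureQuaternion_injective (a := a) (b := b))).1 ?_
  refine mul_self_eq_zero.1 ?_
  rw [pureQuaternion_mul_self, hv, map_zero]

theorem weightedSumSquares_pureCoeff_single_zero :
    weightedSumSquares K (pureCoeff a b) (Pi.single 0 1) = a := by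
  simp [pureCoeff, Fin.sum_univ_three]

theorem weightedSumSquares_pureCoeff_single_one :
    weightedSumSquares K (pureCoeff a b) (Pi.single 1 1) = b := by
  simp [pureCoeff, Fin.sum_univ_three]

theorem IsDivision.left_ne_zero (h : IsDivision ℍ[K,a,b]) : a ≠ 0 := fun ha =>
  Pi.single_ne_zero_iff.2 one_ne_zero
    (h.anisotropic_pureCoeff _ (weightedSumSquares_pureCoeff_single_zero.trans ha))

theorem IsDivision.right_ne_zero (h : IsDivision ℍ[K,a,b]) : b ≠ 0 := fun hb =>
  Pi.single_ne_zero_iff.2 one_ne_zero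
    (h.anisotropic_pureCoeff _ (weightedSumSquares_pureCoeff_single_one.trans hb))

theorem IsDivision.not_isSquare_of_represents (h : IsDivision ℍ[K,a,b]) {d : K} (hd : d ≠ 0)
    {v : Fin 3 → K} (hv : weightedSumSquares K (pureCoeff a b) v = d) : ¬IsSquare d := by
  rintro ⟨s, rfl⟩
  have := h.noZeroDivisors
  let q := pureQuaternion a b v
  have hmul : (q - algebraMap K _ s) * (q + algebraMap K _ s) = 0 := by
    rw [← Commute.mul_self_sub_mul_self_eq' (Algebra.commutes s q).symm, pureQuaternion_mul_self,
      hv, map_mul, sub_self]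
  have hs : s = 0 := by
    rcases mul_eq_zero.1 hmul with h0 | h0 <;>
      simpa [q, pureQuaternion, QuaternionAlgebra.algebraMap_eq] using
        congrArg QuaternionAlgebra.re h0
  exact hd (by rw [hs, zero_mul])

theorem IsDivision.not_isSquare_left (h : IsDivision ℍ[K,a,b]) : ¬IsSquare a :=
  h.not_isSquare_of_represents h.left_ne_zero weightedSumSquares_pureCoeff_single_zero

theorem exists_eq_pureQuaternion_of_re_eq_zero {q : ℍ[K,a,b]} (hq : q.re = 0) :
    ∃ v, q = pureQuaternion a b v :=
  ⟨![q.imI, q.imJ, q.imK], by ext <;> simp [pureQuaternion, hq]⟩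

theorem exists_eq_pureQuaternion (h2 : (2 : K) ≠ 0) {d : K} (hd : ¬IsSquare d) {q : ℍ[K,a,b]}
    (hq : q * q = algebraMap K ℍ[K,a,b] d) :
    ∃ v, q = pureQuaternion a b v ∧ weightedSumSquares K (pureCoeff a b) v = d := by
  have hre : q.re = 0 := by
    rw [QuaternionAlgebra.algebraMap_eq, QuaternionAlgebra.ext_iff] at hq
    simp only [QuaternionAlgebra.re_mul, QuaternionAlgebra.imI_mul, QuaternionAlgebra.imJ_mul,
      QuaternionAlgebra.imK_mul] at hq
    obtain ⟨hr, hi, hj, hk⟩ := hq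
    by_contra h0
    have h20 : 2 * q.re ≠ 0 := mul_ne_zero h2 h0
    have hi0 : q.imI = 0 := mul_left_cancel₀ h20 (by linear_combination hi)
    have hj0 : q.imJ = 0 := mul_left_cancel₀ h20 (by linear_combination hj)
    have hk0 : q.imK = 0 := mul_left_cancel₀ h20 (by linear_combination hk)
    rw [hi0, hj0, hk0] at hr
    exact hd ⟨q.re, by linear_combination -hr⟩
  obtain ⟨v, rfl⟩ := exists_eq_pureQuaternion_of_re_eq_zero hre
  refine ⟨v, rfl, FaithfulSMul.algebraMap_injective K ℍ[K,a,b] ?_⟩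
  rw [← pureQuaternion_mul_self, hq]

/-- The combination of conjugates of `q` below is four times its scalar part, so the kernel of `f`
consists of quaternions all of whose coordinates vanish. -/
theorem quaternion_algHom_injective (h2 : (2 : K) ≠ 0) (ha : a ≠ 0) (hb : b ≠ 0) {A : Type*}
    [Ring A] [Nontrivial A] [Algebra K A] (f : ℍ[K,a,b] →ₐ[K] A) : Function.Injective f := by
  let i : ℍ[K,a,b] := ⟨0, 1, 0, 0⟩
  let j : ℍ[K,a,b] := ⟨0, 0, 1, 0⟩
  let k : ℍ[K,a,b] := ⟨0, 0, 0, 1⟩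
  have re_eq_zero (q : ℍ[K,a,b]) (hq : f q = 0) : q.re = 0 := by
    have h4 : q + a⁻¹ • (i * q * i) + b⁻¹ • (j * q * j) - (a * b)⁻¹ • (k * q * k) =
        algebraMap K ℍ[K,a,b] (2 * 2 * q.re) := by
      rw [QuaternionAlgebra.algebraMap_eq]
      ext <;> simp [i, j, k] <;> field_simp <;> ring
    have := congrArg f h4
    simp only [map_sub, map_add, map_smul, map_mul, hq, mul_zero, zero_mul, smul_zero, add_zero,
      sub_zero, AlgHom.commutes] at this
    simpa only [mul_eq_zero, map_eq_zero_iff _ (FaithfulSMul.algebraMap_injective K A), h2,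
      ← map_mul, false_or] using this.symm
  refine (injective_iff_map_eq_zero f).2 fun q hq => ?_
  have hmul (r : ℍ[K,a,b]) : (q * r).re = 0 := re_eq_zero _ (by rw [map_mul, hq, zero_mul])
  ext
  · exact re_eq_zero q hq
  · simpa [i, ha] using hmul i
  · simpa [j, hb] using hmul j
  · simpa [k, ha, hb] using hmul k

theorem exists_quaternion_algEquiv (h2 : (2 : K) ≠ 0) (ha : a ≠ 0) (hb : b ≠ 0) {A : Type*}
    [Ring A] [Algebra K A] (hA : Module.finrank K A = 4) {v e : A} (hv : v * v = algebraMap K A a)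
    (he : e * e = algebraMap K A b) (hve : v * e = -(e * v)) :
    ∃ f : ℍ[K,a,b] ≃ₐ[K] A, f ⟨0, 1, 0, 0⟩ = v := by
  have : Nontrivial A := Module.nontrivial_of_finrank_pos (R := K) (by lia)
  have : FiniteDimensional K A := Module.finite_of_finrank_pos (by lia)
  let B : QuaternionAlgebra.Basis A a 0 b :=
    { i := v
      j := e
      k := v * e
      i_mul_i := by rw [hv, zero_smul, add_zero, Algebra.algebraMap_eq_smul_one]
      j_mul_j := by rw [he, Algebra.algebraMap_eq_smul_one]
      i_mul_j := rfl
      j_mul_i := by rw [hve, zero_smul, zero_sub, neg_neg] }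
  have hinj := quaternion_algHom_injective h2 ha hb B.liftHom
  have hsurj := (LinearMap.injective_iff_surjective_of_finrank_eq_finrank
    (f := B.liftHom.toLinearMap) (by rw [QuaternionAlgebra.finrank_eq_four, hA])).1 hinj
  exact ⟨AlgEquiv.ofBijective B.liftHom ⟨hinj, hsurj⟩, by
    simp [QuaternionAlgebra.Basis.liftHom, QuaternionAlgebra.Basis.lift, B]⟩

theorem imJ_imK_eq_zero_of_commute (h2 : (2 : K) ≠ 0) (ha : a ≠ 0) {q : ℍ[K,a,b]}
    (hq : Commute q ⟨0, 1, 0, 0⟩) : q.imJ = 0 ∧ q.imK = 0 := by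
  have hJ := congrArg QuaternionAlgebra.imJ hq.eq
  have hK := congrArg QuaternionAlgebra.imK hq.eq
  simp only [QuaternionAlgebra.imJ_mul, QuaternionAlgebra.imK_mul] at hJ hK
  exact ⟨mul_left_cancel₀ h2 (by linear_combination -hK),
    mul_left_cancel₀ (mul_ne_zero h2 ha) (by linear_combination -hJ)⟩

theorem IsDivision.exists_not_commute (h : IsDivision ℍ[K,a,b]) (h2 : (2 : K) ≠ 0) {q : ℍ[K,a,b]}
    (hq0 : q ≠ 0) (hre : q.re = 0) : ∃ u, ¬Commute q u := by
  by_contra! hc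
  obtain ⟨hJ, hK⟩ := imJ_imK_eq_zero_of_commute h2 h.left_ne_zero (hc _)
  have hj := congrArg QuaternionAlgebra.imK (hc ⟨0, 0, 1, 0⟩).eq
  simp only [QuaternionAlgebra.imK_mul, hre, hJ, hK] at hj
  have hI : q.imI = 0 := mul_left_cancel₀ h2 (by linear_combination hj)
  exact hq0 (by ext <;> assumption)

/-- The commutator of `q` with any element anticommutes with `q`. -/
theorem IsDivision.exists_anticommute (h : IsDivision ℍ[K,a,b]) (h2 : (2 : K) ≠ 0) {d : K}
    (hd : ¬IsSquare d) {q : ℍ[K,a,b]} (hq : q * q = algebraMap K ℍ[K,a,b] d) :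
    ∃ (c : K) (e : ℍ[K,a,b]), c ≠ 0 ∧ e * e = algebraMap K ℍ[K,a,b] c ∧ q * e = -(e * q) := by
  have := h.noZeroDivisors
  obtain ⟨u, hu⟩ : ∃ u, ¬Commute q u := by
    obtain ⟨v, rfl, rfl⟩ := exists_eq_pureQuaternion h2 hd hq
    refine h.exists_not_commute h2 (fun h0 => hd ?_) rfl
    rw [(map_eq_zero_iff _ pureQuaternion_injective).1 h0, QuadraticMap.map_zero]
    exact IsSquare.zero
  obtain ⟨w, hw⟩ : ∃ w, q * u - u * q = pureQuaternion a b w :=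
    exists_eq_pureQuaternion_of_re_eq_zero (by
      simp only [QuaternionAlgebra.re_sub, QuaternionAlgebra.re_mul]
      ring)
  have he := pureQuaternion_mul_self (a := a) (b := b) w
  refine ⟨_, _, fun hc => hu ?_, he, ?_⟩
  · rw [hc, map_zero, mul_self_eq_zero, ← hw] at he
    exact sub_eq_zero.1 he
  · rw [← hw, mul_sub, sub_mul, ← mul_assoc, hq, mul_assoc u, hq, Algebra.commutes, mul_assoc]
    abel

theorem IsDivision.exists_algEquiv_of_mul_self_eq (h : IsDivision ℍ[K,a,b]) (h2 : (2 : K) ≠ 0)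
    {d : K} (hd : ¬IsSquare d) {q : ℍ[K,a,b]} (hq : q * q = algebraMap K ℍ[K,a,b] d) :
    ∃ c, c ≠ 0 ∧ ∃ f : ℍ[K,d,c] ≃ₐ[K] ℍ[K,a,b], f ⟨0, 1, 0, 0⟩ = q := by
  obtain ⟨c, e, hc, he, hqe⟩ := h.exists_anticommute h2 hd hq
  have hd0 : d ≠ 0 := fun h0 => hd (h0 ▸ IsSquare.zero)
  exact ⟨c, hc, exists_quaternion_algEquiv h2 hd0 hc (QuaternionAlgebra.finrank_eq_four _ _ _)
    hq he hqe⟩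

theorem IsDivision.exists_eq_of_commute (h : IsDivision ℍ[K,a,b]) (h2 : (2 : K) ≠ 0) {d : K}
    (hd : ¬IsSquare d) {q u : ℍ[K,a,b]} (hq : q * q = algebraMap K ℍ[K,a,b] d)
    (hu : Commute u q) : ∃ s t : K, u = algebraMap K ℍ[K,a,b] s + t • q := by
  obtain ⟨c, -, f, rfl⟩ := h.exists_algEquiv_of_mul_self_eq h2 hd hq
  have hd0 : d ≠ 0 := fun h0 => hd (h0 ▸ IsSquare.zero)
  have hcomm : Commute (f.symm u) ⟨0, 1, 0, 0⟩ := by simpa using hu.map f.symm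
  obtain ⟨hJ, hK⟩ := imJ_imK_eq_zero_of_commute h2 hd0 hcomm
  refine ⟨(f.symm u).re, (f.symm u).imI, f.symm.injective ?_⟩
  rw [map_add, map_smul, AlgEquiv.commutes, f.symm_apply_apply, QuaternionAlgebra.algebraMap_eq]
  ext <;> simp [hJ, hK]

theorem exists_norm_eq_of_anticommute (h : IsDivision ℍ[K,a,b]) (h2 : (2 : K) ≠ 0) {r : K}
    {w u : ℍ[K,a,b]} (hw : w * w = algebraMap K ℍ[K,a,b] a) (hu : u * u = algebraMap K ℍ[K,a,b] r)
    (hwu : w * u = -(u * w)) : ∃ s t : K, s ^ 2 - a * t ^ 2 = b * r := by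
  have hi : (⟨0, 1, 0, 0⟩ : ℍ[K,a,b]) * ⟨0, 1, 0, 0⟩ = algebraMap K ℍ[K,a,b] a := by
    rw [QuaternionAlgebra.algebraMap_eq]
    ext <;> simp
  obtain ⟨u, hu, hiu⟩ := h.exists_anticommute_of_mul_self_eq hi hw hu hwu
  have hre : u.re = 0 := by
    have := congrArg QuaternionAlgebra.imI hiu
    simp only [QuaternionAlgebra.imI_mul, QuaternionAlgebra.imI_neg] at this
    exact mul_left_cancel₀ h2 (by linear_combination this)
  have hI : u.imI = 0 := by
    have := congrArg QuaternionAlgebra.re hiu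
    simp only [QuaternionAlgebra.re_mul, QuaternionAlgebra.re_neg] at this
    exact mul_left_cancel₀ (mul_ne_zero h2 h.left_ne_zero) (by linear_combination this)
  have hr := congrArg QuaternionAlgebra.re hu
  simp only [QuaternionAlgebra.re_mul, QuaternionAlgebra.algebraMap_eq, hre, hI] at hr
  exact ⟨b * u.imJ, b * u.imK, by linear_combination b * hr⟩

theorem anisotropic_one_neg_of_not_isSquare (ha : ¬IsSquare a) :
    (weightedSumSquares K ![1, -a]).Anisotropic := by
  intro v hv
  simp only [weightedSumSquares_apply, Fin.sum_univ_two, Matrix.cons_val_zero,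
    Matrix.cons_val_one, smul_eq_mul] at hv
  have h1 : v 1 = 0 := by
    by_contra h1
    refine ha ⟨v 0 / v 1, ?_⟩
    field_simp
    linear_combination -hv
  have h0 : v 0 = 0 := by simpa [h1] using hv
  funext i
  fin_cases i <;> assumption

theorem not_isDivision_of_norm_eq {s t : K} (h : s ^ 2 - a * t ^ 2 = b) :
    ¬IsDivision ℍ[K,a,b] := by
  intro hD
  have h0 := isDivision_quaternion_iff.1 hD ![s, t, 1, 0] (by
    simp only [normCoeff, weightedSumSquares_apply, Fin.sum_univ_four, Matrix.cons_val, smul_eq_mul]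
    linear_combination h)
  simpa using congrFun h0 2

theorem exists_norm_eq_of_not_isDivision (ha : ¬IsSquare a) (h : ¬IsDivision ℍ[K,a,b]) :
    ∃ s t : K, s ^ 2 - a * t ^ 2 = b := by
  have hani := anisotropic_one_neg_of_not_isSquare ha
  obtain ⟨v, hv, hv0⟩ : ∃ v, weightedSumSquares K (normCoeff a b) v = 0 ∧ v ≠ 0 := by
    simpa [isDivision_quaternion_iff, Anisotropic] using h
  simp only [normCoeff, weightedSumSquares_apply, Fin.sum_univ_four, Matrix.cons_val,
    smul_eq_mul] at hv
  have hn : v 2 ^ 2 - a * v 3 ^ 2 ≠ 0 := by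
    intro hn
    have h23 := hani ![v 2, v 3] (by
      simp only [weightedSumSquares_apply, Fin.sum_univ_two, Matrix.cons_val, smul_eq_mul]
      linear_combination hn)
    have h01 := hani ![v 0, v 1] (by
      simp only [weightedSumSquares_apply, Fin.sum_univ_two, Matrix.cons_val, smul_eq_mul]
      linear_combination hv + b * hn)
    refine hv0 (funext fun i => ?_)
    fin_cases i
    exacts [congrFun h01 0, congrFun h01 1, congrFun h23 0, congrFun h23 1]
  refine ⟨(v 0 * v 2 - a * v 1 * v 3) / (v 2 ^ 2 - a * v 3 ^ 2),
    (v 1 * v 2 - v 0 * v 3) / (v 2 ^ 2 - a * v 3 ^ 2), ?_⟩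
  field_simp
  linear_combination (v 2 ^ 2 - a * v 3 ^ 2) * hv

theorem nonempty_algEquiv_of_norm_eq (h2 : (2 : K) ≠ 0) (ha : a ≠ 0) (hb : b ≠ 0) {c : K}
    (hc : c ≠ 0) {s t : K} (h : s ^ 2 - a * t ^ 2 = b * c) :
    Nonempty (ℍ[K,a,c] ≃ₐ[K] ℍ[K,a,b]) := by
  obtain ⟨f, -⟩ := exists_quaternion_algEquiv h2 ha hc (A := ℍ[K,a,b])
    (QuaternionAlgebra.finrank_eq_four _ _ _) (v := ⟨0, 1, 0, 0⟩) (e := ⟨0, 0, s / b, t / b⟩)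
    (by rw [QuaternionAlgebra.algebraMap_eq]; ext <;> simp)
    (by
      rw [QuaternionAlgebra.algebraMap_eq]
      ext <;> simp <;> field_simp
      · linear_combination h
      · ring)
    (by ext <;> simp)
  exact ⟨f⟩

end QuaternionAlgebras

section BaseChange

theorem weightedSumSquares_algebraMap_comp {ι K L M : Type*} [Fintype ι] [Field K] [Field L]
    [Field M] [Algebra K L] [Algebra K M] [Algebra L M] [IsScalarTower K L M] (c : ι → K) :
    weightedSumSquares M (algebraMap K L ∘ c) = weightedSumSquares M c := by
  ext v
  simp only [weightedSumSquares_apply, Function.comp_apply, algebraMap_smul]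

variable {K : Type*} [Field K] {ι : Type*} [Fintype ι] {c : ι → K}

theorem weightedSumSquares_algebraMap (L : Type*) [Field L] [Algebra K L] (v : ι → K) :
    weightedSumSquares L c (algebraMap K L ∘ v) = algebraMap K L (weightedSumSquares K c v) :=
  (map_weightedSumSquares (Algebra.ofId K L) c v).symm

theorem anisotropic_iff_forall_mem {L : Type*} [Field L] [Algebra K L] {E : IntermediateField K L} :
    (weightedSumSquares E c).Anisotropic ↔
      ∀ v : ι → L, (∀ i, v i ∈ E) → weightedSumSquares L c v = 0 → v = 0 := by
  refine ⟨fun h v hv hv0 => ?_, fun h v hv => ?_⟩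
  · lift v to ι → E using hv
    have h0 := h v (Subtype.ext ((map_weightedSumSquares E.val c v).trans hv0))
    funext i
    exact congrArg E.val (congrFun h0 i)
  · have h0 := h (E.val ∘ v) (fun i => (v i).2) (by rw [← map_weightedSumSquares, hv, map_zero])
    funext i
    exact E.val.injective (congrFun h0 i)

theorem anisotropic_bot (hc : (weightedSumSquares K c).Anisotropic) (L : Type*) [Field L]
    [Algebra K L] : (weightedSumSquares (⊥ : IntermediateField K L) c).Anisotropic := by
  refine anisotropic_iff_forall_mem.2 fun v hv hv0 => ?_
  choose p hp using fun i => mem_bot.1 (hv i)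
  obtain rfl : algebraMap K L ∘ p = v := funext hp
  rw [weightedSumSquares_algebraMap, map_eq_zero] at hv0
  rw [hc p hv0]
  funext i
  simp

variable {L : Type*} [Field L] [Algebra K L] {a b : K}

theorem two_ne_zero_of_algebra (L : Type*) [Field L] [Algebra K L] (h2 : (2 : K) ≠ 0) :
    (2 : L) ≠ 0 := by
  rwa [← map_ofNat (algebraMap K L) 2, _root_.map_ne_zero]

theorem normCoeff_algebraMap :
    normCoeff (algebraMap K L a) (algebraMap K L b) = algebraMap K L ∘ normCoeff a b := by
  funext i
  fin_cases i <;> simp [normCoeff]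

theorem pureCoeff_algebraMap :
    pureCoeff (algebraMap K L a) (algebraMap K L b) = algebraMap K L ∘ pureCoeff a b := by
  funext i
  fin_cases i <;> simp [pureCoeff]

theorem isDivision_quaternion_algebraMap_iff :
    IsDivision ℍ[L,algebraMap K L a,algebraMap K L b] ↔
      (weightedSumSquares L (normCoeff a b)).Anisotropic := by
  rw [isDivision_quaternion_iff, normCoeff_algebraMap, weightedSumSquares_algebraMap_comp]

theorem nonempty_algEquiv_baseChange (h2 : (2 : K) ≠ 0) (ha : a ≠ 0) (hb : b ≠ 0) :
    Nonempty (ℍ[L,algebraMap K L a,algebraMap K L b] ≃ₐ[L] L ⊗[K] ℍ[K,a,b]) := by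
  have h2L := two_ne_zero_of_algebra L h2
  have hmul {q r : ℍ[K,a,b]} {d : K} (h : q * r = algebraMap K ℍ[K,a,b] d) :
      (1 ⊗ₜ q : L ⊗[K] ℍ[K,a,b]) * 1 ⊗ₜ r = algebraMap L (L ⊗[K] ℍ[K,a,b]) (algebraMap K L d) := by
    rw [Algebra.TensorProduct.tmul_mul_tmul, one_mul, h, ← IsScalarTower.algebraMap_apply,
      Algebra.TensorProduct.algebraMap_apply']
  obtain ⟨f, -⟩ := exists_quaternion_algEquiv h2L ((_root_.map_ne_zero (algebraMap K L)).2 ha)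
    ((_root_.map_ne_zero (algebraMap K L)).2 hb) (A := L ⊗[K] ℍ[K,a,b])
    (by rw [Module.finrank_baseChange, QuaternionAlgebra.finrank_eq_four])
    (v := 1 ⊗ₜ ⟨0, 1, 0, 0⟩) (e := 1 ⊗ₜ ⟨0, 0, 1, 0⟩)
    (hmul (by rw [QuaternionAlgebra.algebraMap_eq]; ext <;> simp))
    (hmul (by rw [QuaternionAlgebra.algebraMap_eq]; ext <;> simp))
    (by
      rw [Algebra.TensorProduct.tmul_mul_tmul, Algebra.TensorProduct.tmul_mul_tmul,
        ← TensorProduct.tmul_neg]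
      congr 1
      ext <;> simp)
  exact ⟨f⟩

theorem nonempty_algEquiv_algebraMap (h2 : (2 : K) ≠ 0) (ha : a ≠ 0) (hb : b ≠ 0) {a' b' : K}
    (ha' : a' ≠ 0) (hb' : b' ≠ 0) (f : ℍ[K,a,b] ≃ₐ[K] ℍ[K,a',b']) :
    Nonempty (ℍ[L,algebraMap K L a,algebraMap K L b] ≃ₐ[L]
      ℍ[L,algebraMap K L a',algebraMap K L b']) := by
  obtain ⟨g⟩ := nonempty_algEquiv_baseChange (L := L) h2 ha hb
  obtain ⟨g'⟩ := nonempty_algEquiv_baseChange (L := L) h2 ha' hb'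
  exact ⟨g.trans ((Algebra.TensorProduct.congr AlgEquiv.refl f).trans g'.symm)⟩

end BaseChange

section QuadraticExtension

variable {K E : Type*} [Field K] [Field E] [Algebra K E] {z : E} {g : K}

theorem exists_eq_add_mul_gen (hz : z ^ 2 = algebraMap K E g) (r : K⟮z⟯) :
    ∃ p q : K, r = algebraMap K K⟮z⟯ p + algebraMap K K⟮z⟯ q * AdjoinSimple.gen K z := by
  have hmonic : (X ^ 2 - C g).Monic := monic_X_pow_sub_C g two_ne_zero
  have hroot : aeval z (X ^ 2 - C g) = 0 := by simp [hz]
  obtain ⟨f, hf⟩ : ∃ f : K[X], aeval z f = (r : E) := by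
    rw [← AlgHom.mem_range, ← Algebra.adjoin_singleton_eq_range_aeval,
      ← adjoin_simple_toSubalgebra_of_isAlgebraic ⟨_, hmonic.ne_zero, hroot⟩]
    exact r.2
  obtain ⟨q, p, hqp⟩ := exists_eq_X_add_C_of_natDegree_le_one (p := f %ₘ (X ^ 2 - C g)) (by
    have := natDegree_modByMonic_lt f hmonic
      (fun h1 => by simpa using congrArg natDegree h1)
    rw [natDegree_X_pow_sub_C] at this
    lia)
  refine ⟨p, q, Subtype.ext ?_⟩
  rw [← hf, ← aeval_modByMonic_eq_self_of_root hroot, hqp]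
  simp [add_comm]

variable {ι : Type*} [Fintype ι] {c : ι → K}

theorem polar_weightedSumSquares_algebraMap (L : Type*) [Field L] [Algebra K L] (v w : ι → K) :
    polar (weightedSumSquares L c) (algebraMap K L ∘ v) (algebraMap K L ∘ w) =
      algebraMap K L (polar (weightedSumSquares K c) v w) := by
  have hadd : algebraMap K L ∘ v + algebraMap K L ∘ w = algebraMap K L ∘ (v + w) := by
    funext i
    simp
  simp only [polar, hadd, weightedSumSquares_algebraMap, map_sub]

theorem gen_ne_algebraMap_of_not_anisotropic (hc : (weightedSumSquares K c).Anisotropic)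
    (hM : ¬(weightedSumSquares K⟮z⟯ c).Anisotropic) (s : K) :
    AdjoinSimple.gen K z ≠ algebraMap K K⟮z⟯ s := by
  intro hs
  have hz : z ∈ (⊥ : IntermediateField K E) :=
    mem_bot.2 ⟨s, (congrArg (algebraMap K⟮z⟯ E) hs).symm⟩
  rw [adjoin_simple_eq_bot_iff.2 hz] at hM
  exact hM (anisotropic_bot hc E)

theorem exists_isOrtho_of_not_anisotropic_adjoin_sqrt (hc : (weightedSumSquares K c).Anisotropic)
    (hz : z ^ 2 = algebraMap K E g) (hM : ¬(weightedSumSquares K⟮z⟯ c).Anisotropic) :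
    ∃ p q : ι → K, q ≠ 0 ∧ weightedSumSquares K c p = -(g * weightedSumSquares K c q) ∧
      (weightedSumSquares K c).IsOrtho p q := by
  have hzK := gen_ne_algebraMap_of_not_anisotropic hc hM
  have hgen : AdjoinSimple.gen K z ^ 2 = algebraMap K K⟮z⟯ g := Subtype.ext hz
  have hind {s t : K} (h : algebraMap K K⟮z⟯ s + algebraMap K K⟮z⟯ t * AdjoinSimple.gen K z = 0) :
      s = 0 ∧ t = 0 := by
    obtain rfl : t = 0 := by
      by_contra ht
      have ht' := (_root_.map_ne_zero (algebraMap K K⟮z⟯)).2 ht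
      refine hzK (-s / t) ?_
      rw [map_div₀, map_neg]
      field_simp
      linear_combination h
    exact ⟨by simpa using h, rfl⟩
  obtain ⟨v, hv, hv0⟩ : ∃ v, weightedSumSquares K⟮z⟯ c v = 0 ∧ v ≠ 0 := by
    simpa [Anisotropic] using hM
  choose p q hpq using fun i => exists_eq_add_mul_gen hz (v i)
  obtain rfl : v = algebraMap K K⟮z⟯ ∘ p + AdjoinSimple.gen K z • algebraMap K K⟮z⟯ ∘ q := by
    funext i
    simp [hpq, mul_comm]
  rw [QuadraticMap.map_add (weightedSumSquares K⟮z⟯ c), QuadraticMap.map_smul, polar_smul_right,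
    polar_weightedSumSquares_algebraMap] at hv
  simp only [weightedSumSquares_algebraMap, smul_eq_mul] at hv
  obtain ⟨h1, h2⟩ := hind
    (s := weightedSumSquares K c p + g * weightedSumSquares K c q)
    (t := polar (weightedSumSquares K c) p q) (by
      rw [map_add, map_mul, ← hgen]
      linear_combination hv)
  refine ⟨p, q, ?_, eq_neg_of_add_eq_zero_left h1, ?_⟩
  · rintro rfl
    obtain rfl := hc p (by simpa using h1)
    exact hv0 (by funext i; simp)
  · rw [isOrtho_def, QuadraticMap.map_add (weightedSumSquares K c), h2, add_zero]

/-- Regarding `p` and `q` as quaternions, the quotient `p / q` is pure and has square `g`. -/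
theorem IsDivision.exists_represents_of_isOrtho {a b : K} (h : IsDivision ℍ[K,a,b])
    (h2 : (2 : K) ≠ 0) {p q : Fin 4 → K} (hq : q ≠ 0)
    (hpq : weightedSumSquares K (normCoeff a b) p =
      -(g * weightedSumSquares K (normCoeff a b) q))
    (ho : (weightedSumSquares K (normCoeff a b)).IsOrtho p q) :
    ∃ v, weightedSumSquares K (pureCoeff a b) v = g := by
  have hN : weightedSumSquares K (normCoeff a b) q ≠ 0 := fun h0 =>
    hq (isDivision_quaternion_iff.1 h q h0)
  let e := QuaternionAlgebra.equivTuple a 0 b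
  obtain ⟨w, hw⟩ : ∃ w, e.symm p * star (e.symm q) = pureQuaternion a b w := by
    refine exists_eq_pureQuaternion_of_re_eq_zero ?_
    simp only [isOrtho_def, normCoeff, weightedSumSquares_apply, Fin.sum_univ_four,
      Matrix.cons_val, Pi.add_apply, smul_eq_mul] at ho
    simp only [e, QuaternionAlgebra.re_mul, QuaternionAlgebra.re_star, QuaternionAlgebra.imI_star,
      QuaternionAlgebra.imJ_star, QuaternionAlgebra.imK_star,
      QuaternionAlgebra.equivTuple_symm_apply]
    exact mul_left_cancel₀ h2 (by linear_combination ho)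
  refine ⟨(weightedSumSquares K (normCoeff a b) q)⁻¹ • w, ?_⟩
  have hww : weightedSumSquares K (pureCoeff a b) w =
      g * weightedSumSquares K (normCoeff a b) q ^ 2 := by
    refine FaithfulSMul.algebraMap_injective K ℍ[K,a,b] ?_
    have hstar : star (pureQuaternion a b w) = -pureQuaternion a b w := by
      ext <;> simp [pureQuaternion]
    calc algebraMap K _ (weightedSumSquares K (pureCoeff a b) w)
        = -(pureQuaternion a b w * star (pureQuaternion a b w)) := by
          rw [hstar, mul_neg, neg_neg, pureQuaternion_mul_self]
      _ = -(e.symm p * (star (e.symm q) * e.symm q) * star (e.symm p)) := by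
          rw [← hw, star_mul, star_star]
          simp only [mul_assoc]
      _ = algebraMap K _ (g * weightedSumSquares K (normCoeff a b) q ^ 2) := by
          rw [← (commute_star_quaternion _).eq, mul_star_eq_weightedSumSquares,
            ← Algebra.commutes, mul_assoc, mul_star_eq_weightedSumSquares, ← map_mul, ← map_neg,
            e.apply_symm_apply, e.apply_symm_apply, hpq]
          ring_nf
  rw [QuadraticMap.map_smul, hww, smul_eq_mul]
  field_simp

theorem IsDivision.exists_represents_of_not_anisotropic {a b : K} (h : IsDivision ℍ[K,a,b])
    (h2 : (2 : K) ≠ 0) (hz : z ^ 2 = algebraMap K E g)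
    (hM : ¬(weightedSumSquares K⟮z⟯ (normCoeff a b)).Anisotropic) :
    ∃ v, weightedSumSquares K (pureCoeff a b) v = g := by
  obtain ⟨p, q, hq, hpq, ho⟩ :=
    exists_isOrtho_of_not_anisotropic_adjoin_sqrt (isDivision_quaternion_iff.1 h) hz hM
  exact h.exists_represents_of_isOrtho h2 hq hpq ho

end QuadraticExtension

section GenericSolution

variable {K Ω : Type*} [Field K] [Field Ω] [Algebra K Ω] {a b α β γ : K} {x y z : Ω}

theorem IsDivision.adjoin_simple (h : IsDivision ℍ[K,a,b]) (hy : Transcendental K y) :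
    IsDivision ℍ[K⟮y⟯,algebraMap K K⟮y⟯ a,algebraMap K K⟮y⟯ b] :=
  isDivision_quaternion_algebraMap_iff.2
    (anisotropic_adjoin_simple hy (isDivision_quaternion_iff.1 h))

theorem IsDivision.exists_norm_eq_of_isOrtho (h : IsDivision ℍ[K,a,b]) (h2 : (2 : K) ≠ 0)
    (hα : α ≠ 0) (hy : Transcendental K y) {δ : K⟮y⟯} {w₁ w₀ : Fin 3 → K⟮y⟯}
    (hw₁ : weightedSumSquares K⟮y⟯ (pureCoeff a b) w₁ = algebraMap K K⟮y⟯ α)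
    (hw₀ : weightedSumSquares K⟮y⟯ (pureCoeff a b) w₀ = δ)
    (ho : (weightedSumSquares K⟮y⟯ (pureCoeff a b)).IsOrtho w₁ w₀) :
    ¬IsSquare α ∧ ∃ c : K, c ≠ 0 ∧ ∃ s t : K⟮y⟯,
      s ^ 2 - algebraMap K K⟮y⟯ α * t ^ 2 = algebraMap K K⟮y⟯ c * δ := by
  obtain ⟨-, v, -, hv, -⟩ := exists_isOrtho_of_represents hy h.anisotropic_pureCoeff
    (α := 0) (δ := α) (v := w₁) (by simp [hw₁])
  have hαK := h.not_isSquare_of_represents hα hv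
  obtain ⟨c, hc, f, -⟩ := h.exists_algEquiv_of_mul_self_eq h2 hαK
    ((pureQuaternion_mul_self v).trans (congrArg _ hv))
  obtain ⟨g⟩ := nonempty_algEquiv_algebraMap (L := K⟮y⟯) h2 hα hc h.left_ne_zero h.right_ne_zero f
  rw [← weightedSumSquares_algebraMap_comp (L := K⟮y⟯), ← pureCoeff_algebraMap] at hw₁ hw₀ ho
  refine ⟨hαK, c, hc, exists_norm_eq_of_anticommute ((h.adjoin_simple hy).of_algEquiv g.symm)
    (two_ne_zero_of_algebra _ h2) (w := g.symm (pureQuaternion _ _ w₁))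
    (u := g.symm (pureQuaternion _ _ w₀)) ?_ ?_ ?_⟩
  · rw [← map_mul, pureQuaternion_mul_self, hw₁, AlgEquiv.commutes]
  · rw [← map_mul, pureQuaternion_mul_self, hw₀, AlgEquiv.commutes]
  · rw [← map_mul g.symm, ← map_mul g.symm, ← map_neg, pureQuaternion_anticommute ho]

/-- `c * β` and `c * γ` are the norms of two elements of `K(√α)` orthogonal to each other, and the
determinant of these elements squares to `-c² * β * γ / α`. -/
theorem isSquare_of_norm_eq (hα : ¬IsSquare α) (h2 : (2 : K) ≠ 0) (hy : Transcendental K y) {c : K}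
    (hc : c ≠ 0) {s t : K⟮y⟯} (hst : s ^ 2 - algebraMap K K⟮y⟯ α * t ^ 2 = algebraMap K K⟮y⟯ c *
      (algebraMap K K⟮y⟯ β * AdjoinSimple.gen K y ^ 2 + algebraMap K K⟮y⟯ γ)) :
    IsSquare (-(α * β * γ)) := by
  obtain ⟨f₁, f₀, hf₁, hf₀, ho⟩ := exists_isOrtho_of_represents hy
    (anisotropic_one_neg_of_not_isSquare hα) (α := c * β) (δ := c * γ) (v := ![s, t]) (by
      simp only [weightedSumSquares_apply, Fin.sum_univ_two, Matrix.cons_val, Algebra.smul_def,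
        map_one, map_neg, map_mul]
      linear_combination hst)
  simp only [isOrtho_def, weightedSumSquares_apply, Fin.sum_univ_two, Matrix.cons_val,
    Pi.add_apply, smul_eq_mul] at hf₁ hf₀ ho
  have hpolar : f₁ 0 * f₀ 0 = α * (f₁ 1 * f₀ 1) :=
    mul_left_cancel₀ h2 (by linear_combination ho)
  refine ⟨α * (f₁ 0 * f₀ 1 - f₁ 1 * f₀ 0) / c, ?_⟩
  field_simp
  linear_combination α * (f₀ 0 ^ 2 - α * f₀ 1 ^ 2) * hf₁ + α * c * β * hf₀ -
    α * (f₁ 0 * f₀ 0 - α * (f₁ 1 * f₀ 1)) * hpolar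

theorem IsDivision.isSquare_of_represents (h : IsDivision ℍ[K,a,b]) (h2 : (2 : K) ≠ 0)
    (hα : α ≠ 0) (hy : Transcendental K y) (hx : Transcendental K⟮y⟯ x) {v : Fin 3 → K⟮y⟯⟮x⟯}
    (hv : weightedSumSquares K⟮y⟯⟮x⟯ (pureCoeff a b) v =
      algebraMap K⟮y⟯ K⟮y⟯⟮x⟯ (algebraMap K K⟮y⟯ α) * AdjoinSimple.gen K⟮y⟯ x ^ 2 +
        algebraMap K⟮y⟯ K⟮y⟯⟮x⟯ (algebraMap K K⟮y⟯ β * AdjoinSimple.gen K y ^ 2 +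
          algebraMap K K⟮y⟯ γ)) :
    IsSquare (-(α * β * γ)) := by
  have hL := h.adjoin_simple hy
  have hc := hL.anisotropic_pureCoeff
  rw [← weightedSumSquares_algebraMap_comp (L := K⟮y⟯), ← pureCoeff_algebraMap] at hv
  obtain ⟨w₁, w₀, hw₁, hw₀, ho⟩ := exists_isOrtho_of_represents hx hc hv
  rw [pureCoeff_algebraMap, weightedSumSquares_algebraMap_comp] at hw₁ hw₀ ho
  obtain ⟨hαK, c, hc, s, t, hst⟩ := h.exists_norm_eq_of_isOrtho h2 hα hy hw₁ hw₀ ho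
  exact isSquare_of_norm_eq hαK h2 hy hc hst

theorem IsDivision.anisotropic_adjoin_generic_solution {a' b' d : K} (h : IsDivision ℍ[K,a',b'])
    (h2 : (2 : K) ≠ 0) (ha : a ≠ 0) (hb : b ≠ 0) (hd : ¬IsSquare d)
    (hy : Transcendental K y) (hx : Transcendental K⟮y⟯ x)
    (hz : weightedSumSquares Ω (pureCoeff a b) ![x, y, z] = algebraMap K Ω d) :
    (weightedSumSquares K⟮y⟯⟮x⟯⟮z⟯ (algebraMap K K⟮y⟯⟮x⟯ ∘ normCoeff a' b')).Anisotropic := by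
  have hL := (h.adjoin_simple hy).adjoin_simple hx
  let g : K⟮y⟯⟮x⟯ := algebraMap K⟮y⟯ K⟮y⟯⟮x⟯ (algebraMap K K⟮y⟯ b⁻¹) * AdjoinSimple.gen K⟮y⟯ x ^ 2 +
    algebraMap K⟮y⟯ K⟮y⟯⟮x⟯ (algebraMap K K⟮y⟯ a⁻¹ * AdjoinSimple.gen K y ^ 2 +
      algebraMap K K⟮y⟯ (-(d * (a * b)⁻¹)))
  have hzg : z ^ 2 = algebraMap K⟮y⟯⟮x⟯ Ω g := by
    have ha' : algebraMap K Ω a ≠ 0 := (_root_.map_ne_zero _).2 ha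
    have hb' : algebraMap K Ω b ≠ 0 := (_root_.map_ne_zero _).2 hb
    have hg : algebraMap K⟮y⟯⟮x⟯ Ω g = (algebraMap K Ω b)⁻¹ * x ^ 2 +
        ((algebraMap K Ω a)⁻¹ * y ^ 2 +
          -(algebraMap K Ω d * (algebraMap K Ω a * algebraMap K Ω b)⁻¹)) := by
      simp only [← map_inv₀, ← map_neg, ← map_mul]
      simp only [g, map_add, map_mul, map_pow]
      rfl
    simp only [weightedSumSquares_apply, pureCoeff, Fin.sum_univ_three, Matrix.cons_val,
      Algebra.smul_def, map_neg, map_mul] at hz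
    rw [hg]
    field_simp
    linear_combination -hz
  by_contra hM
  rw [← normCoeff_algebraMap] at hM
  have h2L := two_ne_zero_of_algebra K⟮y⟯⟮x⟯ h2
  obtain ⟨v, hv⟩ := hL.exists_represents_of_not_anisotropic h2L hzg hM
  obtain ⟨s, hs⟩ := h.isSquare_of_represents h2 (inv_ne_zero hb) hy hx (v := v) (by
    rw [← weightedSumSquares_algebraMap_comp (L := K⟮y⟯), ← pureCoeff_algebraMap,
      ← weightedSumSquares_algebraMap_comp (L := K⟮y⟯⟮x⟯), ← pureCoeff_algebraMap]
    exact hv)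
  refine hd ⟨s * (a * b), ?_⟩
  field_simp at hs
  linear_combination hs

end GenericSolution

section ClosedExtension

theorem transcendental_of_forall_algebraMap_mem {F K Ω : Type*} [Field F] [Field K] [Field Ω]
    [Algebra F Ω] [Algebra K Ω] {C : IntermediateField F Ω} (h : ∀ r : K, algebraMap K Ω r ∈ C)
    {y : Ω} (hy : Transcendental C y) : Transcendental K y := by
  let f : K →+* C := (algebraMap K Ω).codRestrict C h
  let _ := f.toAlgebra
  have : IsScalarTower K C Ω := .of_algebraMap_eq fun _ => rfl
  exact fun hK => hy (hK.tower_top C)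

/-- The relative algebraic closure in `Ω` of the subfield generated over `k` by the `s i` with
`i ∈ W`. -/
def relClosure (k : Type*) {Ω I : Type*} [Field k] [Field Ω] [Algebra k Ω] (s : I → Ω)
    (W : Set I) : IntermediateField k Ω :=
  (algebraicClosure (adjoin k (s '' W)) Ω).restrictScalars k

section RelClosure

variable {k Ω I : Type*} [Field k] [Field Ω] [Algebra k Ω] {s : I → Ω} {W : Set I}

theorem mem_relClosure {x : Ω} : x ∈ relClosure k s W ↔ IsAlgebraic (adjoin k (s '' W)) x :=
  mem_algebraicClosure_iff

theorem relClosure_mono {W' : Set I} (h : W ⊆ W') : relClosure k s W ≤ relClosure k s W' := by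
  intro x hx
  rw [mem_relClosure] at hx ⊢
  have hle : adjoin k (s '' W) ≤ adjoin k (s '' W') := adjoin.mono k _ _ (Set.image_mono h)
  let _ := (inclusion hle).toRingHom.toAlgebra
  have : IsScalarTower (adjoin k (s '' W)) (adjoin k (s '' W')) Ω := .of_algebraMap_eq fun _ => rfl
  exact hx.tower_top _

theorem apply_mem_relClosure {i : I} (hi : i ∈ W) : s i ∈ relClosure k s W :=
  mem_relClosure.2 (isAlgebraic_algebraMap
    (⟨s i, subset_adjoin k _ (Set.mem_image_of_mem s hi)⟩ : adjoin k (s '' W)))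

theorem mem_relClosure_of_sq_mem {z : Ω} (hz : z ^ 2 ∈ relClosure k s W) : z ∈ relClosure k s W :=
  mem_relClosure.2 ((mem_relClosure.1 hz).of_pow two_pos)

theorem transcendental_relClosure (hs : AlgebraicIndependent k s) {i : I} (hi : i ∉ W) :
    Transcendental (relClosure k s W) (s i) :=
  (transcendental_adjoin_iff.2 (hs.transcendental_adjoin hi)).algebraicClosure

end RelClosure

open Cardinal in
theorem cardinalMk_algebraicClosure_fractionRing_le {k I : Type u} [Field k] (hI : ℵ₀ ≤ #I)
    (hk : #k ≤ #I) : #(AlgebraicClosure (FractionRing (MvPolynomial I k))) ≤ #I := by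
  have hR : #(MvPolynomial I k) ≤ #I :=
    MvPolynomial.cardinalMk_le_max.trans (max_le (max_le hk le_rfl) hI)
  have hF : #(FractionRing (MvPolynomial I k)) ≤ #I :=
    (IsLocalization.cardinalMk_le (nonZeroDivisors (MvPolynomial I k))).trans hR
  exact (Algebra.IsAlgebraic.cardinalMk_le_max (FractionRing (MvPolynomial I k)) _).trans
    (max_le hF hI)

theorem algebraicIndependent_X_algebraicClosure (k I : Type*) [Field k] :
    AlgebraicIndependent k fun i : I => algebraMap (MvPolynomial I k)
      (AlgebraicClosure (FractionRing (MvPolynomial I k))) (MvPolynomial.X i) := by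
  let R := MvPolynomial I k
  let F := FractionRing R
  refine (MvPolynomial.algebraicIndependent_X I k).map'
    (f := IsScalarTower.toAlgHom k R (AlgebraicClosure F)) ?_
  rw [IsScalarTower.coe_toAlgHom', IsScalarTower.algebraMap_eq R F]
  exact (algebraMap F (AlgebraicClosure F)).injective.comp (IsFractionRing.injective R F)

open Cardinal in
theorem exists_isAlgClosed_algebraicIndependent (k : Type u) [Field k] :
    ∃ (Ω : Type u) (_ : Field Ω) (_ : Algebra k Ω) (s : (Ω × Ω × Ω) × Bool → Ω),
      IsAlgClosed Ω ∧ AlgebraicIndependent k s := by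
  let I := k × ℕ
  let Ω := AlgebraicClosure (FractionRing (MvPolynomial I k))
  have hI : ℵ₀ ≤ #I := aleph0_le_mk I
  have hk : #k ≤ #I := mk_le_of_injective (f := fun x : k => (x, 0)) (Prod.mk_left_injective 0)
  have hΩ : #Ω ≤ #I := cardinalMk_algebraicClosure_fractionRing_le hI hk
  obtain ⟨τ⟩ : #((Ω × Ω × Ω) × Bool) ≤ #I := by
    simp only [mk_prod, lift_id, mk_bool, lift_uzero, lift_ofNat]
    exact mul_le_of_le hI (mul_le_of_le hI hΩ (mul_le_of_le hI hΩ hΩ)) (ofNat_le_aleph0.trans hI)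
  exact ⟨Ω, inferInstance, inferInstance, _, inferInstance,
    (algebraicIndependent_X_algebraicClosure k I).comp τ τ.injective⟩

section AdjoinSimple

variable {k Ω : Type*} [Field k] [Field Ω] [Algebra k Ω] {K C : IntermediateField k Ω}

theorem restrictScalars_adjoin_simple_le {x : Ω} (hK : K ≤ C) (hx : x ∈ C) :
    K⟮x⟯.restrictScalars k ≤ C :=
  fun _ hr => (adjoin_simple_le_iff (K := extendScalars hK)).2 hx hr

theorem le_restrictScalars_adjoin_simple (x : Ω) : K ≤ K⟮x⟯.restrictScalars k :=
  fun r hr => K⟮x⟯.algebraMap_mem ⟨r, hr⟩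

theorem transcendental_apply_of_le_relClosure {I : Type*} {s : I → Ω} {W : Set I} {i : I}
    (hs : AlgebraicIndependent k s) (hK : K ≤ relClosure k s W) (hi : i ∉ W) :
    Transcendental K (s i) :=
  transcendental_of_forall_algebraMap_mem (fun r => hK r.2) (transcendental_relClosure hs hi)

end AdjoinSimple

section Directed

variable {k Ω κ : Type*} [Field k] [Field Ω] [Algebra k Ω] [Nonempty κ]
  {K : κ → IntermediateField k Ω}

theorem mem_iSup_of_directed (hK : Directed (· ≤ ·) K) {x : Ω} : x ∈ ⨆ i, K i ↔ ∃ i, x ∈ K i := by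
  rw [← SetLike.mem_coe, coe_iSup_of_directed hK]
  simp

theorem anisotropic_iSup_of_directed {ι : Type*} [Fintype ι] {c : ι → k}
    (hK : Directed (· ≤ ·) K) (h : ∀ i, (weightedSumSquares (K i) c).Anisotropic) :
    (weightedSumSquares (⨆ i, K i : IntermediateField k Ω) c).Anisotropic := by
  refine anisotropic_iff_forall_mem.2 fun v hv hv0 => ?_
  choose i hi using fun j => (mem_iSup_of_directed hK).1 (hv j)
  obtain ⟨m, hm⟩ := hK.finite_le i
  exact anisotropic_iff_forall_mem.1 (h m) v (fun j => hm j (hi j)) hv0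

end Directed

/-- A partial construction, inside an algebraically closed field `Ω`, of the extension of `k`:
over `K` the division quaternion algebras over `k` remain division algebras, and `d` is the square
of a pure quaternion of `(a, b / K)` for all `(a, b, d) ∈ J`. To each triple are attached two of the
independent transcendental elements `s i`, and `K` involves only those attached to `J`. -/
structure IsStage {k Ω : Type*} [Field k] [Field Ω] [Algebra k Ω] (s : (Ω × Ω × Ω) × Bool → Ω)
    (K : IntermediateField k Ω) (J : Set (Ω × Ω × Ω)) : Prop where
  le_relClosure : K ≤ relClosure k s (J ×ˢ Set.univ)
  isDivision (a b : k) (h : IsDivision ℍ[k,a,b]) : IsDivision ℍ[K,algebraMap k K a,algebraMap k K b]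
  represents (e : Ω × Ω × Ω) (he : e ∈ J) :
    ∃ v : Fin 3 → Ω, (∀ i, v i ∈ K) ∧ weightedSumSquares Ω (pureCoeff e.1 e.2.1) v = e.2.2

section IsStage

variable {k Ω : Type*} [Field k] [Field Ω] [Algebra k Ω] {s : (Ω × Ω × Ω) × Bool → Ω}

theorem IsStage.bot (s : (Ω × Ω × Ω) × Bool → Ω) : IsStage s (⊥ : IntermediateField k Ω) ∅ where
  le_relClosure := bot_le
  isDivision _ _ h := isDivision_quaternion_algebraMap_iff.2
    (anisotropic_bot (isDivision_quaternion_iff.1 h) Ω)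
  represents _ he := he.elim

theorem IsStage.iSup {κ : Type*} [Nonempty κ] {K : κ → IntermediateField k Ω}
    {J : κ → Set (Ω × Ω × Ω)} (hK : Directed (· ≤ ·) K) (h : ∀ i, IsStage s (K i) (J i)) :
    IsStage s (⨆ i, K i) (⋃ i, J i) where
  le_relClosure := iSup_le fun i => (h i).le_relClosure.trans
    (relClosure_mono (Set.prod_mono_left (Set.subset_iUnion J i)))
  isDivision a b hab := isDivision_quaternion_algebraMap_iff.2 (anisotropic_iSup_of_directed hK
    fun i => isDivision_quaternion_algebraMap_iff.1 ((h i).isDivision a b hab))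
  represents e he := by
    obtain ⟨i, hi⟩ := Set.mem_iUnion.1 he
    obtain ⟨v, hvK, hv⟩ := (h i).represents e hi
    exact ⟨v, fun j => le_iSup K i (hvK j), hv⟩

theorem exists_represents_mem_relClosure [IsAlgClosed Ω] {I : Type*} {s : I → Ω} {W : Set I}
    {a b d x y : Ω} (ha0 : a ≠ 0) (hb0 : b ≠ 0) (ha : a ∈ relClosure k s W)
    (hb : b ∈ relClosure k s W) (hd : d ∈ relClosure k s W) (hx : x ∈ relClosure k s W)
    (hy : y ∈ relClosure k s W) :
    ∃ z ∈ relClosure k s W, weightedSumSquares Ω (pureCoeff a b) ![x, y, z] = d := by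
  obtain ⟨z, hz⟩ := IsAlgClosed.exists_pow_nat_eq ((a * x ^ 2 + b * y ^ 2 - d) / (a * b)) two_pos
  refine ⟨z, mem_relClosure_of_sq_mem ?_, ?_⟩
  · rw [hz]
    exact div_mem (sub_mem (add_mem (mul_mem ha (pow_mem hx 2)) (mul_mem hb (pow_mem hy 2))) hd)
      (mul_mem ha hb)
  · simp only [weightedSumSquares_apply, pureCoeff, Fin.sum_univ_three, Matrix.cons_val,
      smul_eq_mul]
    rw [eq_div_iff (mul_ne_zero ha0 hb0)] at hz
    linear_combination -hz

variable {K : IntermediateField k Ω} {J : Set (Ω × Ω × Ω)}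

theorem IsStage.transcendental (h : IsStage s K J) (hs : AlgebraicIndependent k s)
    {e : Ω × Ω × Ω} (he : e ∉ J) :
    Transcendental K (s (e, false)) ∧ Transcendental K⟮s (e, false)⟯ (s (e, true)) := by
  refine ⟨transcendental_apply_of_le_relClosure hs h.le_relClosure fun hmem => he hmem.1,
    transcendental_apply_of_le_relClosure (K := K⟮s (e, false)⟯.restrictScalars k)
      (W := insert (e, false) (J ×ˢ Set.univ)) hs ?_ ?_⟩
  · exact restrictScalars_adjoin_simple_le
      (h.le_relClosure.trans (relClosure_mono (Set.subset_insert _ _)))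
      (apply_mem_relClosure (Set.mem_insert _ _))
  · rintro (hmem | hmem)
    · simp at hmem
    · exact he hmem.1

theorem IsStage.isDivision_adjoin_generic_solution (h : IsStage s K J) (h2 : (2 : k) ≠ 0)
    {a b d : K} (ha : a ≠ 0) (hb : b ≠ 0) (hd : ¬IsSquare d) {x y z : Ω}
    (hy : Transcendental K y) (hx : Transcendental K⟮y⟯ x)
    (hz : weightedSumSquares Ω (pureCoeff (a : Ω) b) ![x, y, z] = d) {K' : IntermediateField k Ω}
    (hK' : ∀ r ∈ K', r ∈ K⟮y⟯⟮x⟯⟮z⟯) {a' b' : k} (hab : IsDivision ℍ[k,a',b']) :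
    IsDivision ℍ[K',algebraMap k K' a',algebraMap k K' b'] := by
  have hz' : weightedSumSquares Ω (pureCoeff a b) ![x, y, z] = algebraMap K Ω d := by
    rw [← weightedSumSquares_algebraMap_comp (L := Ω), ← pureCoeff_algebraMap]
    exact hz
  have hani := (h.isDivision a' b' hab).anisotropic_adjoin_generic_solution
    (two_ne_zero_of_algebra K h2) ha hb hd hy hx hz'
  have : IsScalarTower K K⟮y⟯⟮x⟯ Ω := .of_algebraMap_eq fun _ => rfl
  rw [normCoeff_algebraMap, anisotropic_iff_forall_mem, weightedSumSquares_algebraMap_comp,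
    weightedSumSquares_algebraMap_comp] at hani
  exact isDivision_quaternion_algebraMap_iff.2
    (anisotropic_iff_forall_mem.2 fun v hv => hani v fun i => hK' _ (hv i))

theorem IsStage.exists_insert [IsAlgClosed Ω] (h : IsStage s K J) (hs : AlgebraicIndependent k s)
    (h2 : (2 : k) ≠ 0) {a b d : K} (ha : a ≠ 0) (hb : b ≠ 0) (hd : ¬IsSquare d)
    (he : ((a : Ω), (b : Ω), (d : Ω)) ∉ J) :
    ∃ K' : IntermediateField k Ω, K ≤ K' ∧
      IsStage s K' (insert ((a : Ω), (b : Ω), (d : Ω)) J) := by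
  let e : Ω × Ω × Ω := (a, b, d)
  let x := s (e, true)
  let y := s (e, false)
  let C := relClosure k s (insert e J ×ˢ Set.univ)
  have hKC : K ≤ C :=
    h.le_relClosure.trans (relClosure_mono (Set.prod_mono_left (Set.subset_insert e J)))
  have hxC : x ∈ C := apply_mem_relClosure ⟨Set.mem_insert e J, trivial⟩
  have hyC : y ∈ C := apply_mem_relClosure ⟨Set.mem_insert e J, trivial⟩
  obtain ⟨z, hzC, hz⟩ := exists_represents_mem_relClosure (ZeroMemClass.coe_eq_zero.not.2 ha)
    (ZeroMemClass.coe_eq_zero.not.2 hb) (hKC a.2) (hKC b.2) (hKC d.2) hxC hyC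
  obtain ⟨hy, hx⟩ := h.transcendental hs he
  let K₁ := K⟮y⟯.restrictScalars k
  let K₂ := K₁⟮x⟯.restrictScalars k
  let K₃ := K₂⟮z⟯.restrictScalars k
  have h₁₂ : K₁ ≤ K₂ := le_restrictScalars_adjoin_simple x
  have h₂₃ : K₂ ≤ K₃ := le_restrictScalars_adjoin_simple z
  have hK₃ : K ≤ K₃ := (le_restrictScalars_adjoin_simple y).trans (h₁₂.trans h₂₃)
  refine ⟨K₃, hK₃, restrictScalars_adjoin_simple_le (restrictScalars_adjoin_simple_le
    (restrictScalars_adjoin_simple_le hKC hyC) hxC) hzC, fun _ _ =>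
    h.isDivision_adjoin_generic_solution h2 ha hb hd hy hx hz fun _ => id, ?_⟩
  rintro _ (rfl | he')
  · refine ⟨![x, y, z], ?_, hz⟩
    simp only [Fin.forall_fin_succ, Matrix.cons_val]
    exact ⟨h₂₃ (mem_adjoin_simple_self K₁ x), h₂₃ (h₁₂ (mem_adjoin_simple_self K y)),
      mem_adjoin_simple_self K₂ z, fun i => i.elim0⟩
  · obtain ⟨v, hvK, hv⟩ := h.represents _ he'
    exact ⟨v, fun i => hK₃ (hvK i), hv⟩

theorem IsStage.exists_maximal (s : (Ω × Ω × Ω) × Bool → Ω) :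
    ∃ p : IntermediateField k Ω × Set (Ω × Ω × Ω), Maximal (fun q => IsStage s q.1 q.2) p := by
  refine (zorn_le_nonempty₀ {q : IntermediateField k Ω × Set (Ω × Ω × Ω) | IsStage s q.1 q.2}
    (fun c hcS hc q hq => ?_) (⊥, ∅) (IsStage.bot s)).imp fun _ hp => hp.2
  have : Nonempty c := ⟨⟨q, hq⟩⟩
  have hdir : Directed (· ≤ ·) fun r : c => r.1.1 := fun r₁ r₂ =>
    let ⟨t, h₁, h₂⟩ := hc.directed r₁ r₂
    ⟨t, h₁.1, h₂.1⟩
  exact ⟨(⨆ r : c, r.1.1, ⋃ r : c, r.1.2), IsStage.iSup hdir fun r => hcS r.2, fun r hr =>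
    ⟨le_iSup (fun r : c => r.1.1) ⟨r, hr⟩, Set.subset_iUnion (fun r : c => r.1.2) ⟨r, hr⟩⟩⟩

end IsStage

theorem exists_extension_forall_represents (k : Type u) [Field k] (h2 : (2 : k) ≠ 0) :
    ∃ (K : Type u) (_ : Field K) (_ : Algebra k K),
      (∀ a b : k, IsDivision ℍ[k,a,b] → IsDivision ℍ[K,algebraMap k K a,algebraMap k K b]) ∧
      ∀ a b d : K, a ≠ 0 → b ≠ 0 → ¬IsSquare d →
        ∃ v, weightedSumSquares K (pureCoeff a b) v = d := by
  obtain ⟨Ω, _, _, s, _, hs⟩ := exists_isAlgClosed_algebraicIndependent k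
  obtain ⟨⟨K, J⟩, hmax⟩ := IsStage.exists_maximal (k := k) s
  have h : IsStage s K J := hmax.prop
  refine ⟨K, inferInstance, inferInstance, h.isDivision, fun a b d ha hb hd => ?_⟩
  have he : ((a : Ω), (b : Ω), (d : Ω)) ∈ J := by
    by_contra he
    obtain ⟨K', hK', h'⟩ := h.exists_insert hs h2 ha hb hd he
    exact he ((hmax.le_of_ge (y := (K', _)) h' ⟨hK', Set.subset_insert _ _⟩).2
      (Set.mem_insert _ _))
  obtain ⟨v, hvK, hv⟩ := h.represents _ he
  lift v to Fin 3 → K using hvK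
  refine ⟨v, (algebraMap K Ω).injective ?_⟩
  rw [← weightedSumSquares_algebraMap, ← weightedSumSquares_algebraMap_comp (L := Ω),
    ← pureCoeff_algebraMap]
  exact hv

end ClosedExtension

section MaximalSubfields

variable {K : Type u} [Field K] {A B : Type u} [Ring A] [Ring B] [Algebra K A] [Algebra K B]

theorem algClass_eq_iff : algClass K A = algClass K B ↔ Nonempty (A ≃ₐ[K] B) :=
  Quotient.eq (r := algIsoSetoid K)

theorem IsMaximalSubfield.map {E : Subalgebra K A} (hE : IsMaximalSubfield K E) (e : A ≃ₐ[K] B) :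
    IsMaximalSubfield K (E.map e.toAlgHom) := by
  refine ⟨(e.subalgebraMap E).symm.toMulEquiv.isField hE.prop, fun F hF hle u hu => ?_⟩
  have hF' : IsField (F.map e.symm.toAlgHom) := (e.symm.subalgebraMap F).symm.toMulEquiv.isField hF
  have hEF : E ≤ F.map e.symm.toAlgHom := fun x hx =>
    ⟨e x, hle (Subalgebra.mem_map.2 ⟨x, hx, rfl⟩), e.symm_apply_apply x⟩
  exact ⟨e.symm u, hE.le_of_ge hF' hEF ⟨u, hu, rfl⟩, e.apply_symm_apply u⟩

theorem mem_maxSpectrum_algClass_iff {L : AlgClass K} : L ∈ maxSpectrum (algClass K A) ↔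
    ∃ E : Subalgebra K A, IsMaximalSubfield K E ∧ L = algClass K E := by
  refine ⟨?_, fun ⟨E, hE, hL⟩ => ⟨AlgCat.of K A, rfl, E, hE, hL⟩⟩
  rintro ⟨A', hA', E, hE, rfl⟩
  obtain ⟨e⟩ := algClass_eq_iff.1 hA'.symm
  exact ⟨E.map e.toAlgHom, hE.map e, algClass_eq_iff.2 ⟨e.subalgebraMap E⟩⟩

section SqrtHom

variable {d : K} {v : A}

/-- The homomorphism from `K(√d)` to a `K`-algebra given by a square root `v` of `d`. -/
def sqrtHom (hv : v * v = algebraMap K A d) : QuadraticAlgebra K d 0 →ₐ[K] A :=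
  QuadraticAlgebra.lift ⟨v, by rw [hv, zero_smul, add_zero, Algebra.algebraMap_eq_smul_one]⟩

theorem sqrtHom_apply (hv : v * v = algebraMap K A d) (q : QuadraticAlgebra K d 0) :
    sqrtHom hv q = algebraMap K A q.re + q.im • v := by
  simp [sqrtHom, QuadraticAlgebra.lift, Algebra.algebraMap_eq_smul_one]

theorem mem_range_sqrtHom (hv : v * v = algebraMap K A d) {u : A} :
    u ∈ (sqrtHom hv).range ↔ ∃ s t : K, u = algebraMap K A s + t • v :=
  ⟨fun ⟨q, hq⟩ => ⟨q.re, q.im, hq.symm.trans (sqrtHom_apply hv q)⟩,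
    fun ⟨s, t, h⟩ => ⟨⟨s, t⟩, (sqrtHom_apply hv _).trans h.symm⟩⟩

theorem self_mem_range_sqrtHom (hv : v * v = algebraMap K A d) : v ∈ (sqrtHom hv).range :=
  (mem_range_sqrtHom hv).2 ⟨0, 1, by simp⟩

theorem isField_quadraticAlgebra (hd : ¬IsSquare d) : IsField (QuadraticAlgebra K d 0) := by
  have : Fact (∀ r : K, r ^ 2 ≠ d + 0 * r) := ⟨fun r hr => hd ⟨r, by linear_combination -hr⟩⟩
  exact Field.toIsField _

theorem nonempty_algEquiv_range_sqrtHom [Nontrivial A] (hd : ¬IsSquare d)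
    (hv : v * v = algebraMap K A d) :
    Nonempty (QuadraticAlgebra K d 0 ≃ₐ[K] (sqrtHom hv).range) := by
  let _ := (isField_quadraticAlgebra hd).toField
  exact ⟨AlgEquiv.ofInjective _ (sqrtHom hv).toRingHom.injective⟩

theorem isField_range_sqrtHom [Nontrivial A] (hd : ¬IsSquare d) (hv : v * v = algebraMap K A d) :
    IsField (sqrtHom hv).range :=
  let ⟨e⟩ := nonempty_algEquiv_range_sqrtHom hd hv
  e.symm.toMulEquiv.isField (isField_quadraticAlgebra hd)

theorem notMem_bot_of_mul_self_eq [Nontrivial A] (hd : ¬IsSquare d)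
    (hv : v * v = algebraMap K A d) : v ∉ (⊥ : Subalgebra K A) := by
  intro hmem
  obtain ⟨r, rfl⟩ := Algebra.mem_bot.1 hmem
  rw [← map_mul] at hv
  exact hd ⟨r, (FaithfulSMul.algebraMap_injective K A hv).symm⟩

end SqrtHom

variable {a b : K}

theorem IsDivision.isMaximalSubfield_range_sqrtHom (h : IsDivision ℍ[K,a,b]) (h2 : (2 : K) ≠ 0)
    {d : K} (hd : ¬IsSquare d) {v : ℍ[K,a,b]} (hv : v * v = algebraMap K ℍ[K,a,b] d) :
    IsMaximalSubfield K (sqrtHom hv).range := by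
  refine ⟨isField_range_sqrtHom hd hv, fun E hE hle u hu => ?_⟩
  have huv : Commute u v :=
    congrArg Subtype.val (hE.mul_comm ⟨u, hu⟩ ⟨v, hle (self_mem_range_sqrtHom hv)⟩)
  exact (mem_range_sqrtHom hv).2 (h.exists_eq_of_commute h2 hd hv huv)

theorem IsDivision.exists_sub_mul_self_eq (h : IsDivision ℍ[K,a,b]) {q : ℍ[K,a,b]}
    (hq : q ∉ (⊥ : Subalgebra K ℍ[K,a,b])) : ∃ s d : K, ¬IsSquare d ∧
      (q - algebraMap K ℍ[K,a,b] s) * (q - algebraMap K ℍ[K,a,b] s) = algebraMap K ℍ[K,a,b] d := by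
  obtain ⟨v, hv⟩ := exists_eq_pureQuaternion_of_re_eq_zero (a := a) (b := b)
    (q := q - algebraMap K ℍ[K,a,b] q.re) (by simp [QuaternionAlgebra.algebraMap_eq])
  have hv0 : weightedSumSquares K (pureCoeff a b) v ≠ 0 := by
    intro h0
    rw [h.anisotropic_pureCoeff v h0, map_zero, sub_eq_zero] at hv
    exact hq (Algebra.mem_bot.2 ⟨_, hv.symm⟩)
  exact ⟨q.re, _, h.not_isSquare_of_represents hv0 rfl, hv ▸ pureQuaternion_mul_self v⟩

theorem IsMaximalSubfield.ne_bot {E : Subalgebra K ℍ[K,a,b]} (hE : IsMaximalSubfield K E)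
    (h : IsDivision ℍ[K,a,b]) : E ≠ ⊥ := by
  rintro rfl
  have hi := pureQuaternion_mul_self (a := a) (b := b) (Pi.single 0 1)
  rw [weightedSumSquares_pureCoeff_single_zero] at hi
  exact notMem_bot_of_mul_self_eq h.not_isSquare_left hi
    (hE.le_of_ge (isField_range_sqrtHom h.not_isSquare_left hi) bot_le (self_mem_range_sqrtHom hi))

theorem IsMaximalSubfield.exists_eq_range_sqrtHom {E : Subalgebra K ℍ[K,a,b]}
    (hE : IsMaximalSubfield K E) (h : IsDivision ℍ[K,a,b]) (h2 : (2 : K) ≠ 0) :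
    ∃ (d : K) (v : ℍ[K,a,b]) (hv : v * v = algebraMap K ℍ[K,a,b] d),
      ¬IsSquare d ∧ E = (sqrtHom hv).range := by
  obtain ⟨q, hqE, hq⟩ := SetLike.exists_of_lt (bot_lt_iff_ne_bot.2 (hE.ne_bot h))
  obtain ⟨s, d, hd, hv⟩ := h.exists_sub_mul_self_eq hq
  have hvE := sub_mem hqE (E.algebraMap_mem s)
  have hle : (sqrtHom hv).range ≤ E := by
    intro u hu
    obtain ⟨s', t, rfl⟩ := (mem_range_sqrtHom hv).1 hu
    exact add_mem (E.algebraMap_mem s') (E.smul_mem hvE t)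
  exact ⟨d, _, hv, hd, hle.antisymm' ((h.isMaximalSubfield_range_sqrtHom h2 hd hv).le_of_ge
    hE.prop hle)⟩

theorem IsDivision.mem_maxSpectrum_iff (h : IsDivision ℍ[K,a,b]) (h2 : (2 : K) ≠ 0)
    {L : AlgClass K} : L ∈ maxSpectrum (algClass K ℍ[K,a,b]) ↔
      ∃ d : K, ¬IsSquare d ∧ (∃ v, weightedSumSquares K (pureCoeff a b) v = d) ∧
        L = algClass K (QuadraticAlgebra K d 0) := by
  rw [mem_maxSpectrum_algClass_iff]
  constructor
  · rintro ⟨E, hE, rfl⟩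
    obtain ⟨d, q, hq, hd, rfl⟩ := hE.exists_eq_range_sqrtHom h h2
    obtain ⟨v, -, hv⟩ := exists_eq_pureQuaternion h2 hd hq
    obtain ⟨e⟩ := nonempty_algEquiv_range_sqrtHom hd hq
    exact ⟨d, hd, ⟨v, hv⟩, algClass_eq_iff.2 ⟨e.symm⟩⟩
  · rintro ⟨d, hd, ⟨v, rfl⟩, rfl⟩
    have hv := pureQuaternion_mul_self (a := a) (b := b) v
    exact ⟨_, h.isMaximalSubfield_range_sqrtHom h2 hd hv,
      algClass_eq_iff.2 (nonempty_algEquiv_range_sqrtHom hd hv)⟩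

theorem mem_quatStar_iff {D : AlgClass K} :
    D ∈ QuatStar K ↔ ∃ a b : K, IsDivision ℍ[K,a,b] ∧ D = algClass K ℍ[K,a,b] := by
  constructor
  · rintro ⟨⟨a, b, -, -, rfl⟩, A, hA, hdiv⟩
    obtain ⟨f⟩ := algClass_eq_iff.1 hA
    exact ⟨a, b, hdiv.of_algEquiv f.symm, rfl⟩
  · rintro ⟨a, b, h, rfl⟩
    exact ⟨⟨a, b, h.left_ne_zero, h.right_ne_zero, rfl⟩, AlgCat.of K ℍ[K,a,b], rfl, h⟩

theorem IsDivision.exists_algClass_eq (h : IsDivision ℍ[K,a,b]) (h2 : (2 : K) ≠ 0) {d : K}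
    (hd : ¬IsSquare d) {q : ℍ[K,a,b]} (hq : q * q = algebraMap K ℍ[K,a,b] d) :
    ∃ c, IsDivision ℍ[K,d,c] ∧ algClass K ℍ[K,a,b] = algClass K ℍ[K,d,c] := by
  obtain ⟨c, -, f, -⟩ := h.exists_algEquiv_of_mul_self_eq h2 hd hq
  exact ⟨c, h.of_algEquiv f.symm, algClass_eq_iff.2 ⟨f.symm⟩⟩

theorem Linked.exists_common_slot {D D' : AlgClass K} (hl : Linked D D') (h2 : (2 : K) ≠ 0)
    (hD : D ∈ QuatStar K) (hD' : D' ∈ QuatStar K) :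
    ∃ d c c' : K, IsDivision ℍ[K,d,c] ∧ IsDivision ℍ[K,d,c'] ∧
      D = algClass K ℍ[K,d,c] ∧ D' = algClass K ℍ[K,d,c'] := by
  obtain ⟨a, b, h, rfl⟩ := mem_quatStar_iff.1 hD
  obtain ⟨a', b', h', rfl⟩ := mem_quatStar_iff.1 hD'
  obtain ⟨L, hL, hL'⟩ := hl
  obtain ⟨d, hd, ⟨v, hv⟩, rfl⟩ := (h.mem_maxSpectrum_iff h2).1 hL
  obtain ⟨d', -, ⟨v', hv'⟩, hdd'⟩ := (h'.mem_maxSpectrum_iff h2).1 hL'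
  obtain ⟨f⟩ := algClass_eq_iff.1 hdd'
  let g := (sqrtHom ((pureQuaternion_mul_self v').trans (congrArg _ hv'))).comp f.toAlgHom
  have hω : g QuadraticAlgebra.omega * g QuadraticAlgebra.omega = algebraMap K ℍ[K,a',b'] d := by
    rw [← map_mul, QuadraticAlgebra.omega_mul_omega_eq_add, zero_smul, add_zero, map_smul, map_one,
      Algebra.algebraMap_eq_smul_one]
  obtain ⟨c, hc, hDc⟩ := h.exists_algClass_eq h2 hd
    ((pureQuaternion_mul_self v).trans (congrArg _ hv))
  obtain ⟨c', hc', hDc'⟩ := h'.exists_algClass_eq h2 hd hω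
  exact ⟨d, c, c', hc, hc', hDc, hDc'⟩

theorem IsDivision.nonempty_algEquiv_iff (h : IsDivision ℍ[K,a,b]) (h2 : (2 : K) ≠ 0) {c : K}
    (hc : c ≠ 0) : Nonempty (ℍ[K,a,c] ≃ₐ[K] ℍ[K,a,b]) ↔ ¬IsDivision ℍ[K,a,b * c] := by
  constructor
  · rintro ⟨f⟩
    obtain ⟨s, t, hst⟩ := exists_norm_eq_of_anticommute h h2 (r := c)
      (w := f ⟨0, 1, 0, 0⟩) (u := f ⟨0, 0, 1, 0⟩)
      (by rw [← map_mul, ← f.commutes, QuaternionAlgebra.algebraMap_eq]; congr 1; ext <;> simp)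
      (by rw [← map_mul, ← f.commutes, QuaternionAlgebra.algebraMap_eq]; congr 1; ext <;> simp)
      (by rw [← map_mul f, ← map_mul f, ← map_neg f]; congr 1; ext <;> simp)
    exact not_isDivision_of_norm_eq hst
  · intro hbc
    obtain ⟨s, t, hst⟩ := exists_norm_eq_of_not_isDivision h.not_isSquare_left hbc
    exact nonempty_algEquiv_of_norm_eq h2 h.left_ne_zero h.right_ne_zero hc hst

end MaximalSubfields

section ScalarExtension

variable {k K : Type u} [Field k] [Field K] [Algebra k K]

theorem scalarExt_algClass_quaternion (h2 : (2 : k) ≠ 0) {a b : k} (ha : a ≠ 0) (hb : b ≠ 0) :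
    scalarExt k K (algClass k ℍ[k,a,b]) = algClass K ℍ[K,algebraMap k K a,algebraMap k K b] :=
  (algClass_eq_iff.2 (nonempty_algEquiv_baseChange h2 ha hb)).symm

theorem exists_scalarExt_eq (h2 : (2 : k) ≠ 0)
    (hK : ∀ a b : k, IsDivision ℍ[k,a,b] → IsDivision ℍ[K,algebraMap k K a,algebraMap k K b])
    {D : AlgClass k} (hD : D ∈ QuatStar k) :
    ∃ a b : K, IsDivision ℍ[K,a,b] ∧ scalarExt k K D = algClass K ℍ[K,a,b] := by
  obtain ⟨a, b, h, rfl⟩ := mem_quatStar_iff.1 hD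
  exact ⟨_, _, hK a b h, scalarExt_algClass_quaternion h2 h.left_ne_zero h.right_ne_zero⟩

/-- For `D = (d, c)` and `D' = (d, c')`, both `D ≅ D'` and `D ⊗ K ≅ D' ⊗ K` are expressed by the
quaternion algebra `(d, c' * c)` not being a division algebra, over `k` and over `K`
respectively. -/
theorem Linked.eq_of_scalarExt_eq (h2 : (2 : k) ≠ 0)
    (hK : ∀ a b : k, IsDivision ℍ[k,a,b] → IsDivision ℍ[K,algebraMap k K a,algebraMap k K b])
    {D D' : AlgClass k} (hl : Linked D D') (hD : D ∈ QuatStar k) (hD' : D' ∈ QuatStar k)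
    (heq : scalarExt k K D = scalarExt k K D') : D = D' := by
  obtain ⟨d, c, c', h, h', rfl, rfl⟩ := hl.exists_common_slot h2 hD hD'
  rw [scalarExt_algClass_quaternion h2 h.left_ne_zero h.right_ne_zero,
    scalarExt_algClass_quaternion h2 h'.left_ne_zero h'.right_ne_zero, algClass_eq_iff,
    (hK _ _ h').nonempty_algEquiv_iff (two_ne_zero_of_algebra K h2) (hK _ _ h).right_ne_zero,
    ← map_mul] at heq
  rw [algClass_eq_iff, h'.nonempty_algEquiv_iff h2 h.right_ne_zero]
  exact mt (hK _ _) heq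

end ScalarExtension

section WeakIsomorphism

variable {K : Type u} [Field K] {a b : K}

theorem IsDivision.maxSpectrum_eq_of_forall_represents (h : IsDivision ℍ[K,a,b]) (h2 : (2 : K) ≠ 0)
    (hrep : ∀ d : K, ¬IsSquare d → ∃ v, weightedSumSquares K (pureCoeff a b) v = d) :
    maxSpectrum (algClass K ℍ[K,a,b]) =
      {L | ∃ d : K, ¬IsSquare d ∧ L = algClass K (QuadraticAlgebra K d 0)} := by
  ext L
  rw [h.mem_maxSpectrum_iff h2]
  exact exists_congr fun d => and_congr_right fun hd => and_iff_right (hrep d hd)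

end WeakIsomorphism

theorem theorem3p2_general {k : Type u} [Field k] (hk : ringChar k ≠ 2) :
    ∃ (K : Type u) (_ : Field K) (_ : Algebra k K),
      Set.MapsTo (scalarExt k K) (QuatStar k) (QuatStar K) ∧
      (∀ D ∈ QuatStar k, ∀ D' ∈ QuatStar k, Linked D D' →
        scalarExt k K D = scalarExt k K D' → D = D') ∧
      ∀ D ∈ QuatStar k, ∀ D' ∈ QuatStar k,
        WeaklyIsomorphic (scalarExt k K D) (scalarExt k K D') := by
  have h2 : (2 : k) ≠ 0 := Ring.two_ne_zero hk
  obtain ⟨K, _, _, hK, hrep⟩ := exists_extension_forall_represents k h2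
  have hspec : ∀ D ∈ QuatStar k, maxSpectrum (scalarExt k K D) =
      {L | ∃ d : K, ¬IsSquare d ∧ L = algClass K (QuadraticAlgebra K d 0)} := by
    intro D hD
    obtain ⟨a, b, h, hDab⟩ := exists_scalarExt_eq h2 hK hD
    rw [hDab]
    exact h.maxSpectrum_eq_of_forall_represents (two_ne_zero_of_algebra K h2)
      fun d => hrep a b d h.left_ne_zero h.right_ne_zero
  exact ⟨K, inferInstance, inferInstance,
    fun D hD => mem_quatStar_iff.2 (exists_scalarExt_eq h2 hK hD),
    fun D hD D' hD' hl => hl.eq_of_scalarExt_eq h2 hK hD hD',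
    fun D hD D' hD' => (hspec D hD).trans (hspec D' hD').symm⟩

theorem theorem3p2 {k : Type u} [Field k] (hk : ringChar k ≠ 2)
    (𝒟 : Set (AlgClass k)) (h𝒟 : 𝒟 ⊆ QuatStar k) (hlinked : 𝒟.Pairwise Linked) :
    ∃ (K : Type u) (_ : Field K) (_ : Algebra k K),
      Set.MapsTo (scalarExt k K) 𝒟 (QuatStar K) ∧
      Set.InjOn (scalarExt k K) 𝒟 ∧
      (scalarExt k K '' 𝒟).Pairwise WeaklyIsomorphic := by
  obtain ⟨K, _, _, hmaps, hinj, hweak⟩ := theorem3p2_general hk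
  refine ⟨K, inferInstance, inferInstance, hmaps.mono_left h𝒟, fun D hD D' hD' heq => ?_, ?_⟩
  · by_contra hne
    exact hne (hinj D (h𝒟 hD) D' (h𝒟 hD') (hlinked hD hD' hne) heq)
  · rintro _ ⟨D, hD, rfl⟩ _ ⟨D', hD', rfl⟩ -
    exact hweak D (h𝒟 hD) D' (h𝒟 hD')
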